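/- Let $k$ be a field of characteristic zero and let $A = k\langle x,y\rangle/(x^2,\; y^2x-xy^2-xyx)$ be the super Jordan plane, with enveloping algebra $A^e=A\otimes_k A^{op}$. Consider the following complex $P_\bullet$ of free $A$-bimodules, with differentials $d_n\colon P_{n+1}\to P_n$. Put $P_0=A\otimes A$; let $P_1$ be free on the generators $x,y$, and for $n\ge 2$ let $P_n$ be free on the two generators $x^n$, $y^2x^{n-1}$; write $a\otimes w\otimes b$ for the element $a(1\otimes w\otimes 1)b$. The differentials are $$d_0(1\otimes x\otimes 1)=x\otimes 1-1\otimes x,\qquad d_0(1\otimes y\otimes 1)=y\otimes 1-1\otimes y,$$ $$d_1(1\otimes x^2\otimes 1)=x\otimes x\otimes 1+1\otimes x\otimes x,$$ $$d_1(1\otimes y^2x\otimes 1)=y^2\otimes x\otimes 1+y\otimes y\otimes x+1\otimes y\otimes yx-(xy\otimes y\otimes 1+x\otimes y\otimes y+1\otimes x\otimes y^2)-(xy\otimes x\otimes 1+x\otimes y\otimes x+1\otimes x\otimes yx),$$ and, for $n\ge 2$, $$d_n(1\otimes x^{n+1}\otimes 1)=x\otimes x^n\otimes 1+(-1)^{n+1}\,1\otimes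 x^n\otimes x,$$ $$d_n(1\otimes y^2x^n\otimes 1)=y^2\otimes x^n\otimes 1+(-1)^{n+1}\,1\otimes y^2x^{n-1}\otimes x-(x\otimes y^2x^{n-1}\otimes 1+xy\otimes x^n\otimes 1+1\otimes x^n\otimes y^2+1\otimes x^n\otimes yx).$$ Together with the multiplication $P_0=A\otimes A\to A$, this complex is a projective resolution of $A$ as an $A$-bimodule. Through this resolution, a pair $(a,b)\in A\oplus A$ is regarded as the $n$-cochain $P_n\to A$ ($n\ge1$) taking the value $a$ on $1\otimes x^n\otimes1$, and the value $b$ on $1\otimes y\otimes 1$ if $n=1$, on $1\otimes y^2x^{n-1}\otimes 1$ if $n\ge2$; if it is a cocycle, it has a class in the Hochschild cohomology $HH^n(A,A)=\mathrm{Ext}^n_{A^e}(A,A)$. Then: 1. $HH^0(A,A)\cong k$, and the center of $A$ is $k$. 2. The cocycles $c=(0,x)$ and $s_n=\bigl((2n+1)xy^{2n},\,y^{2n+1}\bigr)$, $n\ge0$, represent a $k$-basis of $HH^1(A,A)$. 3. For every $p\ge1$, the cocycles $t_n^{2p}=(0,\,xy^{2n})$ and $u_n^{2p}=\Bigl(\sum_{i=0}^n\frac{n!}{i!}(yx)^{n-i}y^{2i},\,-y^{2n+1}\Bigr)$,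 $n\ge0$, represent a $k$-basis of $HH^{2p}(A,A)$. 4. For every $p\ge1$, the cocycles $v_n^{2p+1}=\Bigl(0,\,\sum_{i=0}^n\frac{n!}{i!}(yx)^{n-i}y^{2i}\Bigr)$ and $w_n^{2p+1}=\bigl(xy^{2n},\,xy^{2n+1}\bigr)$, $n\ge0$, represent a $k$-basis of $HH^{2p+1}(A,A)$. -/

import Mathlib

open CategoryTheory CategoryTheory.Abelian TensorProduct MulOpposite

universe u

namespace SuperJordanPlane

section Algebra

variable (k : Type u) [Field k]

/-- The defining relations `x² = 0` and `y²x = xy² + xyx` on the free algebra on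
`x = ι 0` and `y = ι 1`. -/
inductive Rel : FreeAlgebra k (Fin 2) → FreeAlgebra k (Fin 2) → Prop
  | sq : Rel (FreeAlgebra.ι k 0 * FreeAlgebra.ι k 0) 0
  | cubic : Rel
      (FreeAlgebra.ι k 1 * FreeAlgebra.ι k 1 * FreeAlgebra.ι k 0)
      (FreeAlgebra.ι k 0 * FreeAlgebra.ι k 1 * FreeAlgebra.ι k 1 +
        FreeAlgebra.ι k 0 * FreeAlgebra.ι k 1 * FreeAlgebra.ι k 0)

/-- The super Jordan plane `A = k⟨x, y⟩ / (x², y²x - xy² - xyx)`. -/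
def A : Type u := RingQuot (Rel k)

noncomputable instance : Ring (A k) := inferInstanceAs (Ring (RingQuot (Rel k)))

noncomputable instance : Algebra k (A k) := inferInstanceAs (Algebra k (RingQuot (Rel k)))

/-- The quotient map from the free algebra. -/
noncomputable def proj : FreeAlgebra k (Fin 2) →ₐ[k] A k := RingQuot.mkAlgHom k (Rel k)

/-- The generator `x` of `A`. -/
noncomputable def x : A k := proj k (FreeAlgebra.ι k 0)

/-- The generator `y` of `A`. -/
noncomputable def y : A k := proj k (FreeAlgebra.ι k 1)

theorem x_mul_x : x k * x k = 0 := by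
  have h : proj k _ = proj k _ := RingQuot.mkAlgHom_rel k (Rel.sq (k := k))
  simpa [x] using h

theorem y_mul_y_mul_x :
    y k * (y k * x k) = x k * (y k * y k) + x k * (y k * x k) := by
  have h : proj k _ = proj k _ := RingQuot.mkAlgHom_rel k (Rel.cubic (k := k))
  simpa [x, y, mul_assoc] using h

/-- The enveloping algebra `Aᵉ = A ⊗ Aᵒᵖ`; its left modules are the `A`-bimodules on which `k` acts
centrally. -/
def Ae : Type u := A k ⊗[k] (A k)ᵐᵒᵖ

noncomputable instance : Ring (Ae k) := inferInstanceAs (Ring (A k ⊗[k] (A k)ᵐᵒᵖ))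

noncomputable instance : Algebra k (Ae k) := inferInstanceAs (Algebra k (A k ⊗[k] (A k)ᵐᵒᵖ))

/-- `A` as a bimodule over itself: `(a ⊗ op b) • z = a * z * b`. -/
noncomputable instance : Module (Ae k) (A k) :=
  TensorProduct.Algebra.module (R := k) (A := A k) (B := (A k)ᵐᵒᵖ) (M := A k)

variable {k} in
/-- The element `a ⊗ b` of `Aᵉ`. -/
noncomputable def ten (a b : A k) : Ae k := (a ⊗ₜ[k] op b : A k ⊗[k] (A k)ᵐᵒᵖ)

variable {k} in
theorem ten_smul (a b z : A k) : ten a b • z = a * (z * b) := by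
  change a • op b • z = _
  simp

variable {k} in
theorem ten_mul_ten (a b c d : A k) : ten a b * ten c d = ten (a * c) (d * b) :=
  Algebra.TensorProduct.tmul_mul_tmul a c (op b) (op d)

variable {k} in
theorem ten_add_left (a a' b : A k) : ten (a + a') b = ten a b + ten a' b :=
  TensorProduct.add_tmul a a' (op b)

variable {k} in
theorem ten_add_right (a b b' : A k) : ten a (b + b') = ten a b + ten a b' :=
  TensorProduct.tmul_add a (op b) (op b')

variable {k} in
theorem ten_zero_left (b : A k) : ten 0 b = 0 := TensorProduct.zero_tmul _ (op b)

variable {k} in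
theorem ten_zero_right (a : A k) : ten a 0 = 0 := TensorProduct.tmul_zero _ a

/-- The regular bimodule `A` as an object of the category of `A`-bimodules. -/
noncomputable abbrev bimod : ModuleCat.{u} (Ae k) := ModuleCat.of (Ae k) (A k)

/-- Hochschild cohomology `HHⁿ(A, A) = Extⁿ_{Aᵉ}(A, A)`. -/
abbrev HH (n : ℕ) : Type u := Ext.{u} (bimod k) (bimod k) n

end Algebra

/-- Generators of the free bimodules in the resolution. In degree `0` there is one generator
`one`. In degree `n ≥ 1`, `xPow` stands for the word `xⁿ`, and `yWord` stands for the word `y` if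
`n = 1` and for the word `y²xⁿ⁻¹` if `n ≥ 2`. -/
inductive Cell : ℕ → Type
  | one : Cell 0
  | xPow (n : ℕ) : Cell (n + 1)
  | yWord (n : ℕ) : Cell (n + 1)

section Resolution

variable (k : Type u) [Field k]

/-- The free bimodule on the generators of degree `n`. -/
abbrev P (n : ℕ) : Type u := Cell n →₀ Ae k

variable {k} in
/-- The element `a ⊗ w ⊗ b` of the free bimodule. -/
noncomputable def el {n : ℕ} (a : A k) (w : Cell n) (b : A k) : P k n :=
  Finsupp.single w (ten a b)

variable {k} in
theorem smul_el {n : ℕ} (a b c d : A k) (w : Cell n) :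
    ten a b • el c w d = el (a * c) w (d * b) := by
  simp [el, ten_mul_ten]

/-- Values of the differential of the resolution on the generators `1 ⊗ w ⊗ 1`. -/
noncomputable def bd : (n : ℕ) → Cell (n + 1) → P k n
  | 0, .xPow _ => el (x k) .one 1 - el 1 .one (x k)
  | 0, .yWord _ => el (y k) .one 1 - el 1 .one (y k)
  | 1, .xPow _ => el (x k) (.xPow 0) 1 + el 1 (.xPow 0) (x k)
  | 1, .yWord _ =>
      el (y k * y k) (.xPow 0) 1 + el (y k) (.yWord 0) (x k) + el 1 (.yWord 0) (y k * x k)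
      - (el (x k * y k) (.yWord 0) 1 + el (x k) (.yWord 0) (y k) + el 1 (.xPow 0) (y k * y k))
      - (el (x k * y k) (.xPow 0) 1 + el (x k) (.yWord 0) (x k) + el 1 (.xPow 0) (y k * x k))
  | n + 2, .xPow _ =>
      el (x k) (.xPow (n + 1)) 1 + (-1 : ℤ) ^ (n + 3) • el 1 (.xPow (n + 1)) (x k)
  | n + 2, .yWord _ =>
      el (y k * y k) (.xPow (n + 1)) 1 + (-1 : ℤ) ^ (n + 3) • el 1 (.yWord (n + 1)) (x k)
      - (el (x k) (.yWord (n + 1)) 1 + el (x k * y k) (.xPow (n + 1)) 1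
        + el 1 (.xPow (n + 1)) (y k * y k) + el 1 (.xPow (n + 1)) (y k * x k))

/-- The differential `P (n + 1) → P n`, a morphism of bimodules. -/
noncomputable def dP (n : ℕ) : P k (n + 1) →ₗ[Ae k] P k n :=
  Finsupp.linearCombination (Ae k) (bd k n)

theorem dP_el (n : ℕ) (a b : A k) (w : Cell (n + 1)) :
    dP k n (el a w b) = ten a b • bd k n w := by
  simp [dP, el]

theorem el_add_left {n : ℕ} (a a' b : A k) (w : Cell n) :
    el (a + a') w b = el a w b + el a' w b := by
  simp [el, ten_add_left]

theorem el_add_right {n : ℕ} (a b b' : A k) (w : Cell n) :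
    el a w (b + b') = el a w b + el a w b' := by
  simp [el, ten_add_right]

theorem el_zero_left {n : ℕ} (b : A k) (w : Cell n) : el 0 w b = 0 := by
  simp [el, ten_zero_left]

theorem el_zero_right {n : ℕ} (a : A k) (w : Cell n) : el a w 0 = 0 := by
  simp [el, ten_zero_right]

theorem x_mul_x_mul (a : A k) : x k * (x k * a) = 0 := by
  rw [← mul_assoc, x_mul_x, zero_mul]

theorem y_mul_y_mul_x_mul (a : A k) :
    y k * (y k * (x k * a)) = x k * (y k * (y k * a)) + x k * (y k * (x k * a)) := by
  have h := congrArg (· * a) (y_mul_y_mul_x k)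
  simpa [mul_assoc, add_mul] using h

theorem dP_bd (n : ℕ) (w : Cell (n + 2)) : dP k n (bd k (n + 1) w) = 0 := by
  have hs : ∀ {j : ℕ} (c : Ae k) (m : ℤ) (q : P k j), c • m • q = m • c • q :=
    fun c m q => smul_comm c m q
  match n, w with
  | 0, .xPow _ =>
    simp only [bd, map_add, dP_el, smul_sub, smul_el, mul_one, one_mul, x_mul_x, el_zero_left,
      el_zero_right]
    abel
  | 0, .yWord _ =>
    simp only [bd, map_add, map_sub, dP_el, smul_sub, smul_el, mul_assoc, mul_one,
      one_mul, y_mul_y_mul_x, el_add_left, el_add_right]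
    abel
  | 1, .xPow _ =>
    simp only [bd, map_add, map_zsmul, dP_el, smul_add, smul_el, mul_one, one_mul, x_mul_x,
      el_zero_left, el_zero_right]
    norm_num
  | 1, .yWord _ =>
    simp only [bd, map_add, map_sub, map_zsmul, dP_el, smul_sub, smul_add, smul_el, mul_assoc,
      mul_one, one_mul, x_mul_x, el_zero_left, y_mul_y_mul_x, el_add_left,
      el_add_right, x_mul_x_mul]
    norm_num
    simp only [el, ten_zero_right, Finsupp.single_zero]
    abel
  | n + 2, .xPow _ =>
    simp only [bd, map_add, map_zsmul, dP_el, smul_add, smul_el, mul_one, one_mul, x_mul_x,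
      el_zero_left, el_zero_right, hs]
    rcases Nat.even_or_odd n with h | h <;>
      simp [pow_add, h.neg_one_pow]
  | n + 2, .yWord _ =>
    simp only [bd, map_add, map_sub, map_zsmul, dP_el, smul_sub, smul_add, smul_el, mul_assoc,
      mul_one, one_mul, x_mul_x, el_zero_left, el_zero_right, y_mul_y_mul_x, el_add_left,
      el_add_right, x_mul_x_mul, hs]
    rcases Nat.even_or_odd n with h | h <;>
      simp [pow_add, h.neg_one_pow] <;>
      simp only [el, ten_zero_right, Finsupp.single_zero] <;> abel

theorem dP_comp_dP (n : ℕ) : dP k n ∘ₗ dP k (n + 1) = 0 := by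
  refine Finsupp.lhom_ext' fun w => LinearMap.ext_ring ?_
  have h : dP k (n + 1) (Finsupp.single w 1) = bd k (n + 1) w := by simp [dP]
  simp only [LinearMap.comp_apply, Finsupp.lsingle_apply, h, dP_bd, LinearMap.zero_apply]

/-- The complex of free bimodules `⋯ → P 2 → P 1 → P 0`. -/
noncomputable def complexP : ChainComplex (ModuleCat.{u} (Ae k)) ℕ :=
  ChainComplex.of (fun n => ModuleCat.of (Ae k) (P k n)) (fun n => ModuleCat.ofHom (dP k n))
    (fun n => by rw [← ModuleCat.ofHom_comp, dP_comp_dP]; rfl)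

/-- The bimodule morphism `P n → A` sending `1 ⊗ w ⊗ 1` to `f w`. -/
noncomputable def cochain {n : ℕ} (f : Cell n → A k) : (complexP k).X n ⟶ bimod k :=
  ModuleCat.ofHom (Finsupp.linearCombination (Ae k) f)

theorem complexP_d (n : ℕ) : (complexP k).d (n + 1) n = ModuleCat.ofHom (dP k n) :=
  ChainComplex.of_d (fun n => ModuleCat.of (Ae k) (P k n)) (fun n => ModuleCat.ofHom (dP k n)) n

theorem d_comp_one : (complexP k).d 1 0 ≫ cochain k (fun _ => 1) = 0 := by
  rw [complexP_d k 0]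
  refine ModuleCat.hom_ext (Finsupp.lhom_ext' fun w => LinearMap.ext_ring ?_)
  change Finsupp.linearCombination (Ae k) (fun _ => (1 : A k)) (dP k 0 (Finsupp.single w 1)) = 0
  match w with
  | .xPow _ => simp [dP, bd, el, ten_smul]
  | .yWord _ => simp [dP, bd, el, ten_smul]

/-- The augmentation, given in degree `0` by the multiplication `a ⊗ 1 ⊗ b ↦ a * b`. -/
noncomputable def augmentation :
    complexP k ⟶ (ChainComplex.single₀ (ModuleCat.{u} (Ae k))).obj (bimod k) :=
  (ChainComplex.toSingle₀Equiv (complexP k) (bimod k)).symm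
    ⟨cochain k (fun _ => 1), d_comp_one k⟩

instance projective_complexP (n : ℕ) : Projective ((complexP k).X n) :=
  inferInstanceAs (Projective (ModuleCat.of (Ae k) (P k n)))

/-- The projective resolution given by the augmented complex, when that complex is exact. -/
noncomputable def resolution (h : QuasiIso (augmentation k)) :
    ProjectiveResolution (bimod k) where
  complex := complexP k
  π := augmentation k

/-- The cochain of degree `n + 1` with value `p.1` on `xⁿ⁺¹`, and value `p.2` on `y` if `n = 0`,
on `y²xⁿ` if `n ≥ 1`. -/
def pair {n : ℕ} (p : A k × A k) : Cell (n + 1) → A k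
  | .xPow _ => p.1
  | .yWord _ => p.2

/-- The members of `f`, read as cochains of degree `n + 1`, are cocycles, and their classes form a
basis of the `k`-vector space `HHⁿ⁺¹(A, A)`. -/
def ClassesFormBasis (h : QuasiIso (augmentation k)) (n : ℕ) {ι : Type} (f : ι → A k × A k) :
    Prop :=
  ∃ hf : ∀ i, (complexP k).d (n + 2) (n + 1) ≫ cochain k (pair k (f i)) = 0,
    ∃ b : Module.Basis ι k (HH k (n + 1)),
      ∀ i, b i = (resolution k h).extMk (cochain k (pair k (f i))) (n + 2) rfl (hf i)

end Resolution

section Cocycles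

variable (k : Type u) [Field k]

/-- `∑ i ≤ n, (n! / i!) (yx)ⁿ⁻ⁱ y²ⁱ`. -/
noncomputable def z (n : ℕ) : A k :=
  ∑ i ∈ Finset.range (n + 1),
    ((n.factorial : k) / (i.factorial : k)) • ((y k * x k) ^ (n - i) * y k ^ (2 * i))

noncomputable def c : A k × A k := (0, x k)

noncomputable def s (n : ℕ) : A k × A k :=
  (((2 * n + 1 : ℕ) : k) • (x k * y k ^ (2 * n)), y k ^ (2 * n + 1))

noncomputable def t (n : ℕ) : A k × A k := (0, x k * y k ^ (2 * n))

noncomputable def u (n : ℕ) : A k × A k := (z k n, -y k ^ (2 * n + 1))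

noncomputable def v (n : ℕ) : A k × A k := (0, z k n)

noncomputable def w (n : ℕ) : A k × A k := (x k * y k ^ (2 * n), x k * y k ^ (2 * n + 1))

end Cocycles

end SuperJordanPlane

/-! Put q = yx and Y = y². The relations give Yq = q(Y + q), qx = 0 and yq = x(Y + q), so every
element of A is f₀ + f₁y + xg₀ + xg₁y with f₀, f₁, g₀, g₁ ordered polynomials in q and Y. This form
is unique because A acts on such quadruples (`coordEquiv`). The ring structure of k[q][Y] is not
that of A: there, multiplication by q models left multiplication by yx, and multiplication by Y
models right multiplication by y². Moving q leftwards across f replaces f by `sg f`, where `sg`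
inverts 1 - q d/dY (`sg_eq`). Cocycle equations thus become equations in k[q][Y], solved by
separating the value at q = 0 (`pi`) from the quotient by q (`qt`).

On pairs (a, b) the Hochschild differentials are built from the anticommutator `Lp` and commutator
`Lm` with x, and from an operator `T` commuting with both. The kernel of `Lp` modulo the image of
`Lm` is x·k[Y], and the kernel of `Lm` modulo the image of `Lp` is k[Y + q] (`exists_of_Lp_eq_zero`,
`exists_of_Lm_eq_zero` and the two injectivity lemmas after them). From degree 2 on, each of the two
entries of a cocycle contributes one such family; those of the first entry lift to cocycles by
`T_aeval_z` and `T_x_mul_aeval`. The monomial bases give the stated classes, because the sum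
defining `z k n` is (Y + q)ⁿ (`z_eq`).

In degree 1 the second entry passes through an additional operator `E`. By `exists_E_add` this does
not change the coboundaries of degree 2, and `exists_of_Lm_E_eq_zero` gives HH¹. Characteristic zero
allows halving, integrating in Y, and inverting the operators p + mXp'.

Exactness of the resolution has three ingredients: a contraction stripping x off the right tensor
factor in degrees at least 3, the same contraction up to a locally nilpotent error in degree 2, and
the universal derivation in degree 1. -/

namespace SuperJordanPlane

/-! ### Operators on ordered polynomials in q and Y. -/

section NormalForms

open Polynomial

variable (k : Type u) [Field k]

/-- Normally ordered polynomials `∑ pₘ(q) Yᵐ`, where `q` stands for `yx` and `Y` for `y²`. -/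
abbrev R : Type u := k[X][X]

variable {k}

/-- Apply a linear map to each coefficient. -/
noncomputable def coeffwise (φ : k[X] →ₗ[k] k[X]) : R k →ₗ[k] R k :=
  Polynomial.lsum fun m => ((monomial m : k[X] →ₗ[k[X]] R k).restrictScalars k) ∘ₗ φ

theorem coeffwise_C_mul_X_pow (φ : k[X] →ₗ[k] k[X]) (p : k[X]) (m : ℕ) :
    coeffwise φ (C p * X ^ m) = C (φ p) * X ^ m := by
  rw [C_mul_X_pow_eq_monomial, C_mul_X_pow_eq_monomial, coeffwise, Polynomial.lsum_apply,
    sum_monomial_index] <;> simp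

theorem R_induction {motive : R k → Prop} (f : R k)
    (add : ∀ f g, motive f → motive g → motive (f + g))
    (mon : ∀ (p : k[X]) (m : ℕ), motive (C p * X ^ m)) : motive f := by
  induction f using Polynomial.induction_on' with
  | add f g hf hg => exact add f g hf hg
  | monomial m p => simpa [C_mul_X_pow_eq_monomial] using mon p m

/-- The value at `q = 0`. -/
noncomputable def pi : R k →+* R k := (mapRingHom C).comp (mapRingHom (evalRingHom 0))

/-- The division by `q`, which is zero on polynomials in `Y`. -/
noncomputable def qt : R k →ₗ[k] R k :=
  coeffwise { toFun := divX, map_add' := fun _ _ => divX_add, map_smul' := fun r p => by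
                simp [smul_eq_C_mul, divX_C_mul] }

/-- The derivation `q² d/dq`. -/
noncomputable def qD : R k →ₗ[k] R k :=
  coeffwise (LinearMap.mulLeft k (X ^ 2) ∘ₗ derivative)

/-- Left multiplication by `y² + yx` on normally ordered polynomials. -/
noncomputable def zh : R k →ₗ[k] R k :=
  LinearMap.mulLeft k X + LinearMap.mulLeft k (C X) + qD

theorem zh_apply (f : R k) : zh f = X * f + C X * f + qD f := rfl

/-- The normal form of `(y² + yx)ᵐ`. -/
noncomputable def zeta : ℕ → R k
  | 0 => 1
  | m + 1 => X ^ (m + 1) + ((m + 1 : ℕ) : R k) * (C X * zeta m)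

/-- The map with `f * q = q * sg f`. -/
noncomputable def sg : R k →ₗ[k[X]] R k := Polynomial.lsum fun m => LinearMap.toSpanSingleton _ _ (zeta m)

theorem sg_C_mul (p : k[X]) (f : R k) : sg (C p * f) = C p * sg f := by
  rw [← smul_eq_C_mul, map_smul, smul_eq_C_mul]

theorem sg_X_pow (m : ℕ) : sg (X ^ m : R k) = zeta m := by
  rw [← monomial_one_right_eq_X_pow, sg, Polynomial.lsum_apply, sum_monomial_index] <;> simp

theorem pi_pi (f : R k) : pi (pi f) = pi f := by
  simp [pi, Polynomial.map_map]
  congr 1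
  ext <;> simp

@[simp] theorem pi_X : pi (X : R k) = X := by simp [pi]

@[simp] theorem pi_C_X : pi (C X : R k) = 0 := by simp [pi]

theorem pi_C_mul_X_pow (p : k[X]) (m : ℕ) : pi (C p * X ^ m : R k) = C (C (p.coeff 0)) * X ^ m := by
  simp [pi, coeff_zero_eq_eval_zero]

theorem pi_add_qt (f : R k) : pi f + C X * qt f = f := by
  induction f using R_induction with
  | add f g hf hg => simp only [map_add]; linear_combination hf + hg
  | mon p m =>
    rw [pi_C_mul_X_pow, qt, coeffwise_C_mul_X_pow]
    have h : (C (p.divX * X + C (p.coeff 0)) : R k) = C p := by rw [divX_mul_X_add]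
    simp only [C_add, C_mul] at h
    change _ + C X * (C p.divX * X ^ m) = _
    linear_combination X ^ m * h

theorem qt_C_X_mul (f : R k) : qt (C X * f) = f := by
  induction f using R_induction with
  | add f g hf hg => simp only [mul_add, map_add, hf, hg]
  | mon p m =>
    rw [← mul_assoc, ← C_mul, qt, coeffwise_C_mul_X_pow]
    change C (X * p).divX * X ^ m = _
    congr 2
    ext n
    simp [coeff_divX, coeff_X_mul]

theorem qt_pi (f : R k) : qt (pi f) = 0 := by
  have h := pi_add_qt (pi f)
  rw [pi_pi] at h
  simpa using h

theorem pi_C_X_mul (f : R k) : pi (C X * f) = 0 := by simp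

theorem exists_of_pi_eq_zero {f : R k} (h : pi f = 0) : f = C X * qt f := by
  simpa [h] using (pi_add_qt f).symm

theorem qD_C_X_mul (f : R k) : qD (C X * f) = C X * (C X * f + qD f) := by
  induction f using R_induction with
  | add f g hf hg => simp only [mul_add, map_add] at *; rw [hf, hg]; ring
  | mon p m =>
    rw [← mul_assoc, ← C_mul, qD, coeffwise_C_mul_X_pow, coeffwise_C_mul_X_pow]
    simp only [LinearMap.comp_apply, LinearMap.mulLeft_apply, derivative_mul, derivative_X]
    simp only [C_add, C_mul, C_pow, C_1]
    ring

theorem pi_qD (f : R k) : pi (qD f) = 0 := by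
  induction f using R_induction with
  | add f g hf hg => simp only [map_add, hf, hg, add_zero]
  | mon p m => rw [qD, coeffwise_C_mul_X_pow]; simp [pi]

theorem pi_derivative (f : R k) : pi (derivative f) = derivative (pi f) := by
  simp [pi, derivative_map]

theorem derivative_C_X_mul (f : R k) : derivative (C X * f) = C X * derivative f := by
  simp

/-- The `zeta m` form an Appell sequence for d/dY; this is what makes `sg` commute with d/dY and
invert 1 - q d/dY. -/
theorem derivative_zeta (m : ℕ) :
    derivative (zeta (m + 1) : R k) = ((m + 1 : ℕ) : R k) * zeta m := by
  induction m with
  | zero => simp [zeta]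
  | succ m ih =>
    have h : (zeta (m + 1) : R k) = X ^ (m + 1) + ((m + 1 : ℕ) : R k) * (C X * zeta m) := rfl
    rw [zeta, derivative_add, derivative_mul, derivative_C_X_mul, ih, h]
    simp
    ring

/-- With `sg_sub`, this says that `sg` is the two-sided inverse of 1 - q d/dY. Later computations
use this characterisation in place of the coefficients n!/i!. -/
theorem sg_eq (f : R k) : sg f = f + C X * derivative (sg f) := by
  induction f using R_induction with
  | add f g hf hg => simp only [map_add, mul_add]; linear_combination hf + hg
  | mon p m =>
    rw [sg_C_mul, sg_X_pow, derivative_C_mul]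
    cases m with
    | zero => simp [zeta]
    | succ m => rw [derivative_zeta, zeta]; ring

theorem sg_sub (f : R k) : sg (f - C X * derivative f) = f := by
  induction f using R_induction with
  | add f g hf hg => simp only [map_add, mul_add, map_sub] at *; linear_combination hf + hg
  | mon p m =>
    cases m with
    | zero =>
      have h := sg_C_mul p (X ^ 0)
      rw [sg_X_pow] at h
      simpa [zeta] using h
    | succ m =>
      have : (C p * X ^ (m + 1) - C X * derivative (C p * X ^ (m + 1)) : R k)
          = C p * (X ^ (m + 1) - C (((m + 1 : ℕ) : k[X]) * X) * X ^ m) := by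
        simp only [derivative_C_mul, derivative_X_pow, C_mul, add_tsub_cancel_right, map_natCast]
        ring
      rw [this, sg_C_mul, map_sub, sg_C_mul, sg_X_pow, sg_X_pow, zeta]
      simp only [C_mul, map_natCast]
      ring

theorem pi_sg (f : R k) : pi (sg f) = pi f := by
  rw [sg_eq]; simp

theorem pi_zh (f : R k) : pi (zh f) = X * pi f := by
  simp [zh_apply, pi_qD]

theorem sg_smul (r : k) (f : R k) : sg (r • f) = r • sg f := by
  rw [← algebraMap_smul k[X] r f, map_smul, algebraMap_smul]

theorem pi_smul (r : k) (f : R k) : pi (r • f) = r • pi f := by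
  have h (g : R k) : r • g = C (C r) * g := by
    rw [Algebra.smul_def]; rfl
  rw [h, h, map_mul]; congr 1; simp [pi]

end NormalForms

end SuperJordanPlane

namespace SuperJordanPlane

/-! ### The normal form basis of A. -/

section Coordinates

open Polynomial

variable {k : Type u} [Field k]

/-- Evaluation of normally ordered polynomials at `q = yx`, `Y = y²`. -/
noncomputable def nf : R k →ₗ[k] A k :=
  Polynomial.lsum fun m =>
    LinearMap.mulRight k ((y k * y k) ^ m) ∘ₗ (aeval (y k * x k) : k[X] →ₐ[k] A k).toLinearMap

theorem nf_mon (p : k[X]) (m : ℕ) :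
    nf (C p * X ^ m) = aeval (y k * x k) p * (y k * y k) ^ m := by
  rw [C_mul_X_pow_eq_monomial, nf, Polynomial.lsum_apply, sum_monomial_index] <;> simp

theorem nf_X_mul (f : R k) : nf (X * f) = nf f * (y k * y k) := by
  induction f using R_induction with
  | add f g hf hg => simp only [mul_add, map_add, add_mul, hf, hg]
  | mon p m =>
    have : (X : R k) * (C p * X ^ m) = C p * X ^ (m + 1) := by ring
    rw [this, nf_mon, nf_mon, pow_succ, mul_assoc]

theorem nf_C_mul (p : k[X]) (f : R k) : nf (C p * f) = aeval (y k * x k) p * nf f := by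
  induction f using R_induction with
  | add f g hf hg => simp only [mul_add, map_add, hf, hg]
  | mon p' m => rw [← mul_assoc, ← C_mul, nf_mon, nf_mon, map_mul, mul_assoc]

theorem nf_C_X_mul (f : R k) : nf (C X * f) = y k * x k * nf f := by
  rw [nf_C_mul, aeval_X]

theorem yy_mul_q : y k * y k * (y k * x k) = y k * x k * (y k * y k + y k * x k) := by
  simp only [mul_assoc, mul_add, y_mul_y_mul_x]

theorem x_mul_x' (a : A k) : x k * (x k * a) = 0 := x_mul_x_mul k a

/-- Since Yq = qY + q², the commutator with Y acts on polynomials in q as the derivation q² d/dq. -/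
theorem yy_mul_aeval (p : k[X]) :
    y k * y k * aeval (y k * x k) p =
      aeval (y k * x k) p * (y k * y k) + aeval (y k * x k) (X ^ 2 * derivative p) := by
  induction p using Polynomial.induction_on with
  | C r => simp [Algebra.commutes]
  | add f g hf hg => simp only [map_add, mul_add, add_mul, hf, hg]; abel
  | monomial n r h =>
    have e : (C r * X ^ (n + 1) : k[X]) = C r * X ^ n * X := by ring
    have e' : X ^ 2 * derivative (C r * X ^ n * X) =
      X ^ 2 * derivative (C r * X ^ n) * X + C r * X ^ n * X * X := by
      rw [derivative_mul, derivative_X]; ring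
    rw [e, e', map_mul, map_add, ← mul_assoc, h, aeval_X, add_mul, mul_assoc, yy_mul_q]
    simp only [map_mul, aeval_X]
    noncomm_ring

theorem nf_zh (f : R k) : nf (zh f) = (y k * y k + y k * x k) * nf f := by
  have h : nf (X * f + qD f) = y k * y k * nf f := by
    induction f using R_induction with
    | add f g hf hg => simp only [mul_add, map_add] at *; rw [← hf, ← hg]; abel
    | mon p m =>
      rw [map_add, nf_X_mul, nf_mon, qD, coeffwise_C_mul_X_pow, nf_mon,
        ← mul_assoc (y k * y k) (aeval _ p), yy_mul_aeval, add_mul]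
      simp only [LinearMap.comp_apply, LinearMap.mulLeft_apply, mul_assoc, ← pow_succ, ← pow_succ']
  rw [zh_apply, add_right_comm, map_add, h, nf_C_X_mul, add_mul]

theorem yy_pow_mul_x (m : ℕ) : (y k * y k) ^ m * x k = x k * (y k * y k + y k * x k) ^ m := by
  induction m with
  | zero => simp
  | succ m ih =>
    rw [pow_succ, mul_assoc, mul_assoc, y_mul_y_mul_x, ← mul_add, ← mul_assoc, ih, mul_assoc,
      ← pow_succ]

theorem yy_pow_mul_q (m : ℕ) :
    (y k * y k) ^ m * (y k * x k) = y k * x k * (y k * y k + y k * x k) ^ m := by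
  rw [mul_assoc, ← yy_pow_mul_x, ← mul_assoc, ← mul_assoc]
  congr 1
  exact ((Commute.refl (y k)).mul_left (Commute.refl _)).pow_left m

theorem nf_zeta (m : ℕ) : nf (zeta m : R k) = (y k * y k + y k * x k) ^ m := by
  have h1 : zh (zeta 0 : R k) = zeta 1 := by
    have : qD (1 : R k) = 0 := by
      have := coeffwise_C_mul_X_pow (LinearMap.mulLeft k (X ^ 2) ∘ₗ derivative) (1 : k[X]) 0
      simpa [qD] using this
    simp [zeta, zh_apply, this]
  have h2 (f : R k) : zh (C X * f) = C X * (zh f + C X * f) := by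
    rw [zh_apply, qD_C_X_mul, zh_apply]; ring
  have h3 (n : ℕ) : zh (X ^ n : R k) = X ^ (n + 1) + C X * X ^ n := by
    have := coeffwise_C_mul_X_pow (LinearMap.mulLeft k (X ^ 2) ∘ₗ derivative) (1 : k[X]) n
    rw [zh_apply, qD]
    simp only [map_one, one_mul] at this
    rw [this]; simp; ring
  -- The closed recursion defining `zeta` agrees with repeated left multiplication by Y + q.
  have h4 (n : ℕ) : zh (zeta n : R k) = zeta (n + 1) := by
    induction n with
    | zero => exact h1
    | succ n ih =>
      rw [zeta, map_add, h3, ← nsmul_eq_mul, map_nsmul, h2, ih]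
      simp only [zeta, nsmul_eq_mul]
      push_cast
      ring
  induction m with
  | zero => simpa [zeta] using nf_mon (1 : k[X]) 0
  | succ m ih => rw [← h4, nf_zh, ih, pow_succ']

theorem nf_mul_q (f : R k) : nf f * (y k * x k) = y k * x k * nf (sg f) := by
  induction f using R_induction with
  | add f g hf hg => simp only [map_add, mul_add, add_mul, hf, hg]
  | mon p m =>
    have h := congrArg (aeval (y k * x k)) (mul_comm p X)
    rw [map_mul, map_mul, aeval_X] at h
    rw [nf_mon, sg_C_mul, sg_X_pow, nf_C_mul, nf_zeta, mul_assoc, yy_pow_mul_q,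
      ← mul_assoc (aeval _ p), h, mul_assoc]

theorem aeval_mul_x (p : k[X]) : aeval (y k * x k) p * x k = p.coeff 0 • x k := by
  conv_lhs => rw [← divX_mul_X_add p]
  simp only [map_add, map_mul, aeval_X, aeval_C, add_mul, mul_assoc, x_mul_x, mul_zero, zero_add,
    Algebra.smul_def]

theorem nf_mul_x (f : R k) : nf f * x k = x k * nf (sg (pi f)) := by
  induction f using R_induction with
  | add f g hf hg => simp only [map_add, mul_add, add_mul, hf, hg]
  | mon p m =>
    rw [pi_C_mul_X_pow, nf_mon, sg_C_mul, sg_X_pow, nf_C_mul, nf_zeta, mul_assoc, yy_pow_mul_x,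
      ← mul_assoc, aeval_mul_x, aeval_C, ← Algebra.smul_def, smul_mul_assoc, mul_smul_comm]

/-- Split f into its part free of q, which commutes with y, and q times a quotient, for which yq =
y²x = x(Y + q). -/
theorem y_mul_nf (f : R k) : y k * nf f = nf (pi f) * y k + x k * nf (zh (qt f)) := by
  conv_lhs => rw [← pi_add_qt f]
  have h : y k * nf (pi f) = nf (pi f) * y k := by
    induction f using R_induction with
    | add f g hf hg => simp only [map_add, mul_add, add_mul, hf, hg]
    | mon p m =>
      rw [pi_C_mul_X_pow, nf_mon, aeval_C, ← Algebra.smul_def, mul_smul_comm, smul_mul_assoc]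
      congr 1
      exact ((Commute.refl (y k)).mul_right (Commute.refl _)).pow_right m
  rw [map_add, mul_add, h, nf_C_X_mul, nf_zh]
  congr 1
  have := y_mul_y_mul_x_mul k (nf (qt f))
  simpa only [add_mul, mul_add, mul_assoc] using this

variable (k) in
/-- Coordinates on `A`: `(f₀, f₁, g₀, g₁)` stands for `f₀ + f₁y + xg₀ + xg₁y`. -/
abbrev Coord : Type u := R k × R k × R k × R k

noncomputable def ofCoord : Coord k →ₗ[k] A k where
  toFun a := nf a.1 + nf a.2.1 * y k + x k * nf a.2.2.1 + x k * nf a.2.2.2 * y k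
  map_add' a b := by simp only [Prod.fst_add, Prod.snd_add, map_add, add_mul, mul_add]; abel
  map_smul' r a := by
    simp only [Prod.smul_fst, Prod.smul_snd, map_smul, mul_smul_comm, smul_mul_assoc, smul_add,
      RingHom.id_apply]

theorem ofCoord_mk (f₀ f₁ g₀ g₁ : R k) :
    ofCoord (f₀, f₁, g₀, g₁) = nf f₀ + nf f₁ * y k + x k * nf g₀ + x k * nf g₁ * y k := rfl

/-- The value at `q = 0`, as a linear map. -/
noncomputable def piL : R k →ₗ[k] R k where
  toFun := pi
  map_add' := map_add pi
  map_smul' := pi_smul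

/-- Left multiplication by `x` in coordinates. -/
noncomputable def lx : Coord k →ₗ[k] Coord k :=
  LinearMap.prod 0 (LinearMap.prod 0
    (LinearMap.prod (LinearMap.fst k _ _) (LinearMap.fst k _ _ ∘ₗ LinearMap.snd k _ _)))

/-- Left multiplication by `y` in coordinates. -/
noncomputable def ly : Coord k →ₗ[k] Coord k :=
  let f₀ : Coord k →ₗ[k] R k := LinearMap.fst k _ _
  let f₁ : Coord k →ₗ[k] R k := LinearMap.fst k _ _ ∘ₗ LinearMap.snd k _ _
  let g₀ : Coord k →ₗ[k] R k := LinearMap.fst k _ _ ∘ₗ LinearMap.snd k _ _ ∘ₗ LinearMap.snd k _ _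
  let g₁ : Coord k →ₗ[k] R k := LinearMap.snd k _ _ ∘ₗ LinearMap.snd k _ _ ∘ₗ LinearMap.snd k _ _
  LinearMap.prod (LinearMap.mulLeft k X ∘ₗ piL ∘ₗ f₁ + LinearMap.mulLeft k (C X) ∘ₗ g₀)
    (LinearMap.prod (piL ∘ₗ f₀ + LinearMap.mulLeft k (C X) ∘ₗ g₁)
      (LinearMap.prod (zh ∘ₗ qt ∘ₗ f₀) (zh ∘ₗ qt ∘ₗ f₁)))

theorem ly_mk (f₀ f₁ g₀ g₁ : R k) : ly (f₀, f₁, g₀, g₁) =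
    (X * pi f₁ + C X * g₀, pi f₀ + C X * g₁, zh (qt f₀), zh (qt f₁)) := rfl

theorem lx_mk (f₀ f₁ g₀ g₁ : R k) : lx (f₀, f₁, g₀, g₁) = (0, 0, f₀, f₁) := rfl

theorem ofCoord_lx (a : Coord k) : ofCoord (lx a) = x k * ofCoord a := by
  obtain ⟨f₀, f₁, g₀, g₁⟩ := a
  simp only [lx_mk, ofCoord_mk, map_zero, zero_mul, mul_add, mul_assoc, x_mul_x', add_zero,
    zero_add]

theorem ofCoord_ly (a : Coord k) : ofCoord (ly a) = y k * ofCoord a := by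
  obtain ⟨f₀, f₁, g₀, g₁⟩ := a
  simp only [ly_mk, ofCoord_mk, map_add, nf_X_mul, nf_C_X_mul, mul_add, add_mul]
  rw [y_mul_nf f₀, ← mul_assoc (y k) (nf f₁), y_mul_nf f₁]
  simp only [mul_assoc, add_mul]
  abel

theorem lx_lx (a : Coord k) : lx (lx a) = 0 := rfl

/-- The cubic relation for the coordinate operators. It amounts to the identity `h` below, obtained
by applying `zh` to the decomposition of f into its value at q = 0 and a multiple of q. -/
theorem ly_ly_lx (a : Coord k) :
    ly (ly (lx a)) = lx (ly (ly a)) + lx (ly (lx a)) := by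
  obtain ⟨f₀, f₁, g₀, g₁⟩ := a
  have h (f : R k) : zh f = X * pi f + C X * zh (qt f) + C X * f := by
    have e := pi_add_qt f
    have h0 : qD (pi f) = 0 := by
      induction f using R_induction with
      | add f g hf hg => simp only [map_add, hf (pi_add_qt f), hg (pi_add_qt g), add_zero]
      | mon p m => rw [pi_C_mul_X_pow, qD, coeffwise_C_mul_X_pow]; simp
    conv_lhs => rw [← e]
    rw [map_add, zh_apply, zh_apply, qD_C_X_mul, h0, zh_apply]
    linear_combination C X * e
  simp only [lx_mk, ly_mk, Prod.mk_add_mk, Prod.mk.injEq]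
  simp only [map_zero, mul_zero, zero_add, add_zero, map_add, qt_C_X_mul, map_mul, pi_X, pi_pi,
    pi_C_X, zero_mul, true_and]
  exact ⟨by rw [h f₀], by rw [h f₁]⟩

/-- The action of `A` on coordinates by left multiplication. -/
noncomputable def act : A k →ₐ[k] Module.End k (Coord k) :=
  RingQuot.liftAlgHom k (s := Rel k) ⟨FreeAlgebra.lift k ![lx, ly], by
    rintro _ _ (_ | _)
    · refine LinearMap.ext fun a => ?_
      simpa using lx_lx a
    · refine LinearMap.ext fun a => ?_
      simpa using ly_ly_lx a⟩

theorem act_x : act (x k) = lx := by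
  change RingQuot.liftAlgHom k _ (RingQuot.mkAlgHom k _ _) = _
  rw [RingQuot.liftAlgHom_mkAlgHom_apply]
  simp

theorem act_y : act (y k) = ly := by
  change RingQuot.liftAlgHom k _ (RingQuot.mkAlgHom k _ _) = _
  rw [RingQuot.liftAlgHom_mkAlgHom_apply]
  simp

theorem A_induction {motive : A k → Prop} (a : A k) (one : motive 1)
    (add : ∀ a b, motive a → motive b → motive (a + b))
    (smul : ∀ (r : k) a, motive a → motive (r • a))
    (x_mul : ∀ a, motive a → motive (x k * a)) (y_mul : ∀ a, motive a → motive (y k * a)) :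
    motive a := by
  suffices h : ∀ (f : FreeAlgebra k (Fin 2)) (b : A k), motive b → motive (proj k f * b) by
    obtain ⟨f, rfl⟩ := RingQuot.mkAlgHom_surjective k (Rel k) a
    have h1 := h f 1 one
    rwa [mul_one] at h1
  intro f
  induction f using FreeAlgebra.induction with
  | grade0 r => intro b hb; simpa [Algebra.smul_def] using smul r b hb
  | grade1 i => intro b hb; fin_cases i <;> [exact x_mul b hb; exact y_mul b hb]
  | mul f g hf hg => intro b hb; rw [map_mul, mul_assoc]; exact hf _ (hg _ hb)
  | add f g hf hg => intro b hb; rw [map_add, add_mul]; exact add _ _ (hf _ hb) (hg _ hb)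

theorem nf_one : nf (1 : R k) = 1 := by simpa using nf_mon (1 : k[X]) 0

theorem ofCoord_act (a : A k) (b : Coord k) : ofCoord (act a b) = a * ofCoord b := by
  induction a using A_induction generalizing b with
  | one => simp
  | add a a' h h' => simp [h, h', add_mul]
  | smul r a h => simp [h]
  | x_mul a h => rw [map_mul, act_x, Module.End.mul_apply, ofCoord_lx, h, mul_assoc]
  | y_mul a h => rw [map_mul, act_y, Module.End.mul_apply, ofCoord_ly, h, mul_assoc]

/-- On vectors free of q, powers of Y act by plain multiplication, because `qt` vanishes there;
applying a polynomial in q afterwards is again plain multiplication. The order of the two matters,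
and is that of the normal form. -/
theorem act_nf (f : R k) (h : R k) (i : R k) (hh : pi h = h) (hi : pi i = i):
    act (nf f) (h, i, 0, 0) = (f * h, f * i, 0, 0) := by
  have hq (p : k[X]) (f₀ f₁ : R k) :
      act (aeval (y k * x k) p) (f₀, f₁, 0, 0) = (C p * f₀, C p * f₁, 0, 0) := by
    induction p using Polynomial.induction_on with
    | C r =>
      have e (g : R k) : r • g = C (C r) * g := by rw [Algebra.smul_def]; rfl
      rw [aeval_C, AlgHom.commutes, Module.algebraMap_end_apply]
      simp [e]
    | add p p' h h' => simp [h, h', add_mul]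
    | monomial n r h =>
      have e : (C r * X ^ (n + 1) : k[X]) = X * (C r * X ^ n) := by ring
      rw [e, map_mul, map_mul, Module.End.mul_apply, h, aeval_X, map_mul, act_x, act_y,
        Module.End.mul_apply, lx_mk, ly_mk]
      simp [mul_assoc]
  have hY (m : ℕ) : act ((y k * y k) ^ m) (h, i, 0, 0) = (X ^ m * h, X ^ m * i, 0, 0) := by
    induction m with
    | zero => simp
    | succ m ih =>
      rw [pow_succ', map_mul, Module.End.mul_apply, ih, map_mul, act_y, Module.End.mul_apply,
        ly_mk, ly_mk]
      have h0 (m : ℕ) (g : R k) (hg : pi g = g) : qt (X ^ m * g) = 0 := by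
        rw [← qt_pi (X ^ m * g)]; simp [hg]
      have h1 := h0 (m + 1) i hi
      rw [pow_succ', mul_assoc] at h1
      simp [h0, h1, hh, hi, pow_succ', mul_assoc]
  induction f using R_induction with
  | add f g hf hg => simp [hf, hg, add_mul]
  | mon p m => rw [nf_mon, map_mul, Module.End.mul_apply, hY, hq, mul_assoc, mul_assoc]

/-- Linear independence of the normal forms: acting on the quadruple of the unit reads the
coordinates back. -/
theorem act_ofCoord (a : Coord k) : act (ofCoord a) (1, 0, 0, 0) = a := by
  obtain ⟨f₀, f₁, g₀, g₁⟩ := a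
  have hy : ly ((1, 0, 0, 0) : Coord k) = (0, 1, 0, 0) := by
    have h : qt (1 : R k) = 0 := by simpa using qt_pi (1 : R k)
    simp only [ly_mk, h, map_zero, mul_zero, map_one, add_zero]
  have h1 (f : R k) := act_nf f _ _ (map_one pi) (map_zero pi)
  have h2 (f : R k) := act_nf f _ _ (map_zero pi) (map_one pi)
  simp only [ofCoord_mk, map_add, map_mul, LinearMap.add_apply, Module.End.mul_apply, act_x,
    act_y, hy, h1, h2, lx_mk, Prod.mk_add_mk, mul_one, mul_zero, add_zero, zero_add]

variable (k) in
/-- `A` in coordinates. -/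
noncomputable def coordEquiv : Coord k ≃ₗ[k] A k where
  __ := ofCoord
  invFun a := act a (1, 0, 0, 0)
  left_inv := act_ofCoord
  right_inv a := by
    change ofCoord (act a _) = a
    rw [ofCoord_act]
    simp [ofCoord_mk, nf_one]

end Coordinates

end SuperJordanPlane

namespace SuperJordanPlane

/-! ### Kernels and images of the commutators with x and y. -/

section Commutators

open Polynomial

variable {k : Type u} [Field k]

theorem ofCoord_injective : Function.Injective (ofCoord : Coord k → A k) :=
  (coordEquiv k).injective

theorem exists_ofCoord (a : A k) : ∃ f₀ f₁ g₀ g₁ : R k, a = ofCoord (f₀, f₁, g₀, g₁) :=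
  let ⟨⟨f₀, f₁, g₀, g₁⟩, h⟩ := (coordEquiv k).surjective a
  ⟨f₀, f₁, g₀, g₁, h.symm⟩

theorem ofCoord_eq_iff {f₀ f₁ g₀ g₁ f₀' f₁' g₀' g₁' : R k} :
    ofCoord (f₀, f₁, g₀, g₁) = ofCoord (f₀', f₁', g₀', g₁') ↔
      f₀ = f₀' ∧ f₁ = f₁' ∧ g₀ = g₀' ∧ g₁ = g₁' := by
  rw [ofCoord_injective.eq_iff, Prod.mk.injEq, Prod.mk.injEq, Prod.mk.injEq]

theorem ofCoord_eq_zero_iff {f₀ f₁ g₀ g₁ : R k} :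
    ofCoord (f₀, f₁, g₀, g₁) = 0 ↔ f₀ = 0 ∧ f₁ = 0 ∧ g₀ = 0 ∧ g₁ = 0 := by
  rw [← ofCoord_eq_iff, show ((0, 0, 0, 0) : Coord k) = 0 from rfl, map_zero]

theorem ofCoord_add {f₀ f₁ g₀ g₁ f₀' f₁' g₀' g₁' : R k} :
    ofCoord (f₀, f₁, g₀, g₁) + ofCoord (f₀', f₁', g₀', g₁') =
      ofCoord (f₀ + f₀', f₁ + f₁', g₀ + g₀', g₁ + g₁') := by
  rw [← map_add]; rfl

theorem ofCoord_sub {f₀ f₁ g₀ g₁ f₀' f₁' g₀' g₁' : R k} :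
    ofCoord (f₀, f₁, g₀, g₁) - ofCoord (f₀', f₁', g₀', g₁') =
      ofCoord (f₀ - f₀', f₁ - f₁', g₀ - g₀', g₁ - g₁') := by
  rw [← map_sub]; rfl

theorem x_mul_ofCoord (f₀ f₁ g₀ g₁ : R k) :
    x k * ofCoord (f₀, f₁, g₀, g₁) = ofCoord (0, 0, f₀, f₁) := by
  rw [← ofCoord_lx, lx_mk]

theorem y_mul_ofCoord (f₀ f₁ g₀ g₁ : R k) : y k * ofCoord (f₀, f₁, g₀, g₁) =
    ofCoord (X * pi f₁ + C X * g₀, pi f₀ + C X * g₁, zh (qt f₀), zh (qt f₁)) := by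
  rw [← ofCoord_ly, ly_mk]

theorem ofCoord_mul_x (f₀ f₁ g₀ g₁ : R k) : ofCoord (f₀, f₁, g₀, g₁) * x k =
    ofCoord (C X * sg f₁, 0, sg (pi f₀) + C X * sg g₁, 0) := by
  simp only [ofCoord_mk, map_add, map_zero, zero_mul, mul_zero, add_zero, add_mul, mul_add]
  rw [nf_mul_x, mul_assoc (nf f₁), nf_mul_q, mul_assoc (x k) (nf g₀), nf_mul_x, x_mul_x',
    mul_assoc (x k * nf g₁), mul_assoc (x k), nf_mul_q, nf_C_X_mul, nf_C_X_mul]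
  abel

theorem ofCoord_mul_y (f₀ f₁ g₀ g₁ : R k) : ofCoord (f₀, f₁, g₀, g₁) * y k =
    ofCoord (X * f₁, f₀, X * g₁, g₀) := by
  simp only [ofCoord_mk, nf_X_mul, add_mul, mul_assoc]
  abel

variable (k) in
/-- The anticommutator with `x`. -/
noncomputable def Lp : A k →ₗ[k] A k := LinearMap.mulLeft k (x k) + LinearMap.mulRight k (x k)

variable (k) in
/-- The commutator with `x`. -/
noncomputable def Lm : A k →ₗ[k] A k := LinearMap.mulLeft k (x k) - LinearMap.mulRight k (x k)

variable (k) in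
/-- The commutator with `y`. -/
noncomputable def Dy : A k →ₗ[k] A k := LinearMap.mulLeft k (y k) - LinearMap.mulRight k (y k)

variable (k) in
/-- The operator `b ↦ yb + by - xb`. -/
noncomputable def E : A k →ₗ[k] A k :=
  LinearMap.mulLeft k (y k) + LinearMap.mulRight k (y k) - LinearMap.mulLeft k (x k)

variable (k) in
/-- The operator `a ↦ y²a - xya - ay² - ayx`. -/
noncomputable def T : A k →ₗ[k] A k :=
  LinearMap.mulLeft k (y k * y k) - LinearMap.mulLeft k (x k * y k)
    - LinearMap.mulRight k (y k * y k) - LinearMap.mulRight k (y k * x k)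

theorem Lp_apply (a : A k) : Lp k a = x k * a + a * x k := rfl
theorem Lm_apply (a : A k) : Lm k a = x k * a - a * x k := rfl
theorem Dy_apply (a : A k) : Dy k a = y k * a - a * y k := rfl
theorem E_apply (a : A k) : E k a = y k * a + a * y k - x k * a := rfl
theorem T_apply (a : A k) : T k a =
    y k * y k * a - x k * y k * a - a * (y k * y k) - a * (y k * x k) := rfl

theorem Lp_ofCoord (f₀ f₁ g₀ g₁ : R k) : Lp k (ofCoord (f₀, f₁, g₀, g₁)) =
    ofCoord (C X * sg f₁, 0, f₀ + sg (pi f₀) + C X * sg g₁, f₁) := by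
  rw [Lp_apply, x_mul_ofCoord, ofCoord_mul_x, ofCoord_add, ofCoord_eq_iff]
  exact ⟨by ring, by ring, by ring, by ring⟩

theorem Lm_ofCoord (f₀ f₁ g₀ g₁ : R k) : Lm k (ofCoord (f₀, f₁, g₀, g₁)) =
    ofCoord (-(C X * sg f₁), 0, f₀ - sg (pi f₀) - C X * sg g₁, f₁) := by
  rw [Lm_apply, x_mul_ofCoord, ofCoord_mul_x, ofCoord_sub, ofCoord_eq_iff]
  exact ⟨by ring, by ring, by ring, by ring⟩

theorem Dy_ofCoord (f₀ f₁ g₀ g₁ : R k) : Dy k (ofCoord (f₀, f₁, g₀, g₁)) =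
    ofCoord (X * pi f₁ + C X * g₀ - X * f₁, pi f₀ + C X * g₁ - f₀, zh (qt f₀) - X * g₁,
      zh (qt f₁) - g₀) := by
  rw [Dy_apply, y_mul_ofCoord, ofCoord_mul_y, ofCoord_sub]

theorem E_ofCoord (f₀ f₁ g₀ g₁ : R k) : E k (ofCoord (f₀, f₁, g₀, g₁)) =
    ofCoord (X * pi f₁ + C X * g₀ + X * f₁, pi f₀ + C X * g₁ + f₀,
      zh (qt f₀) + X * g₁ - f₀, zh (qt f₁) + g₀ - f₁) := by
  rw [E_apply, y_mul_ofCoord, ofCoord_mul_y, x_mul_ofCoord, ofCoord_add, ofCoord_sub]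
  simp only [sub_zero]

theorem T_Lm (a : A k) : T k (Lm k a) = Lm k (T k a) := by
  have h := y_mul_y_mul_x_mul k a
  have h' : a * (y k * (y k * x k)) = a * (x k * (y k * y k)) + a * (x k * (y k * x k)) := by
    rw [y_mul_y_mul_x, mul_add]
  simp only [T_apply, Lm_apply, mul_sub, sub_mul, mul_assoc, x_mul_x, x_mul_x', mul_zero, h, h']
  abel

theorem T_Lp (a : A k) : T k (Lp k a) = Lp k (T k a) := by
  have h := y_mul_y_mul_x_mul k a
  have h' : a * (y k * (y k * x k)) = a * (x k * (y k * y k)) + a * (x k * (y k * x k)) := by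
    rw [y_mul_y_mul_x, mul_add]
  simp only [T_apply, Lp_apply, mul_sub, sub_mul, add_mul, mul_add, mul_assoc, x_mul_x, x_mul_x',
    mul_zero, h, h']
  abel

/-- The operators `E ∘ Dy` and `T` differ by a ↦ xay + ayx, whose values commute with x, and `T`
preserves the commutant of x. -/
theorem Lm_E_Dy {a : A k} (ha : Lm k a = 0) : Lm k (E k (Dy k a)) = 0 := by
  have hT := T_Lm a
  rw [ha, map_zero] at hT
  rw [hT]
  simp only [T_apply, E_apply, Dy_apply, Lm_apply, mul_sub, sub_mul, add_mul, mul_add, mul_assoc,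
    x_mul_x, x_mul_x', mul_zero]
  abel

/-- Polynomials in `Y`, as normally ordered polynomials. -/
noncomputable def emb : k[X] →+* R k := mapRingHom C

theorem pi_emb (h : k[X]) : pi (emb h) = emb h := by
  rw [pi, RingHom.comp_apply, emb]
  congr 1
  simp only [coe_mapRingHom, Polynomial.map_map]
  conv_rhs => rw [← Polynomial.map_id (p := h)]
  congr 1
  ext
  simp

theorem exists_emb_eq_pi (f : R k) : ∃ h, pi f = emb h := ⟨_, rfl⟩

theorem emb_injective : Function.Injective (emb : k[X] → R k) := Polynomial.map_injective _ C_injective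

theorem emb_X : emb (X : k[X]) = X := by simp [emb]

theorem derivative_emb (h : k[X]) : derivative (emb h) = emb (derivative h) := by
  simp [emb, derivative_map]

theorem nf_emb (h : k[X]) : nf (emb h) = aeval (y k * y k) h := by
  induction h using Polynomial.induction_on' with
  | add f g hf hg => simp only [map_add, hf, hg]
  | monomial m r =>
    rw [← C_mul_X_pow_eq_monomial, map_mul emb, map_pow emb, emb_X, map_mul (aeval _),
      map_pow (aeval _), aeval_X, aeval_C]
    simpa [emb] using nf_mon (C r) m

theorem nf_sg_emb (h : k[X]) : nf (sg (emb h)) = aeval (y k * y k + y k * x k) h := by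
  induction h using Polynomial.induction_on' with
  | add f g hf hg => simp only [map_add, hf, hg]
  | monomial m r =>
    rw [← C_mul_X_pow_eq_monomial, map_mul emb, map_pow emb, emb_X, map_mul (aeval _),
      map_pow (aeval _), aeval_X, aeval_C]
    have : emb (C r) = C (C r) := by simp [emb]
    rw [this, sg_C_mul, nf_C_mul, sg_X_pow, nf_zeta, aeval_C]

theorem x_mul_aeval (h : k[X]) : x k * aeval (y k * y k) h = ofCoord (0, 0, emb h, 0) := by
  simp [ofCoord_mk, nf_emb]

theorem aeval_z (h : k[X]) :
    aeval (y k * y k + y k * x k) h = ofCoord (sg (emb h), 0, 0, 0) := by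
  simp [ofCoord_mk, nf_sg_emb]

theorem sg_eq_zero {f : R k} (h : sg f = 0) : f = 0 := by
  have := sg_eq f; simpa [h] using this.symm

theorem C_X_mul_cancel {f g : R k} (h : C X * f = C X * g) : f = g :=
  mul_left_cancel₀ (by simp) h

theorem exists_derivative_eq [CharZero k] {B : Type*} [CommRing B] [Algebra k B] (f : B[X]) :
    ∃ g, derivative g = f := by
  induction f using Polynomial.induction_on' with
  | add f g hf hg =>
    obtain ⟨f', rfl⟩ := hf
    obtain ⟨g', rfl⟩ := hg
    exact ⟨f' + g', derivative_add⟩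
  | monomial n a =>
    refine ⟨monomial (n + 1) (((n + 1 : ℕ) : k)⁻¹ • a), ?_⟩
    rw [derivative_monomial]
    congr 1
    have h : ((n + 1 : ℕ) : k) ≠ 0 := Nat.cast_ne_zero.mpr n.succ_ne_zero
    have h' : ((n + 1 : ℕ) : B) = algebraMap k B ((n + 1 : ℕ) : k) := by simp
    rw [h', mul_comm, ← Algebra.smul_def, smul_smul, mul_inv_cancel₀ h, one_smul]

theorem exists_derivative_sg [CharZero k] (f : R k) : ∃ g, derivative (sg g) = f := by
  obtain ⟨g, hg⟩ := exists_derivative_eq (k := k) f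
  exact ⟨g - C X * derivative g, by rw [sg_sub, hg]⟩

/-- Monomials are eigenvectors of p ↦ p + mXp' with eigenvalues mn + 1, nonzero in characteristic
zero. The case m = 2 produces the factor 2n + 1 in the cocycles `s`. -/
theorem coeff_euler (m n : ℕ) (p : k[X]) :
    (p + (m : k[X]) * (X * derivative p)).coeff n = ((m * n + 1 : ℕ) : k) * p.coeff n := by
  rw [coeff_add, coeff_natCast_mul]
  cases n with
  | zero => simp
  | succ n => rw [coeff_X_mul, coeff_derivative]; push_cast; ring

theorem euler_injective [CharZero k] (m : ℕ) {p : k[X]}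
    (h : p + (m : k[X]) * (X * derivative p) = 0) : p = 0 := by
  ext n
  have h1 := coeff_euler m n p
  rw [h, coeff_zero, eq_comm, mul_eq_zero] at h1
  exact h1.resolve_left (Nat.cast_ne_zero.mpr (Nat.succ_ne_zero _))

theorem euler_surjective [CharZero k] (m : ℕ) (p : k[X]) :
    ∃ r : k[X], r + (m : k[X]) * (X * derivative r) = p := by
  induction p using Polynomial.induction_on' with
  | add f g hf hg =>
    obtain ⟨f', rfl⟩ := hf
    obtain ⟨g', rfl⟩ := hg
    exact ⟨f' + g', by rw [derivative_add]; ring⟩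
  | monomial n a =>
    have h : ((m * n + 1 : ℕ) : k) ≠ 0 := Nat.cast_ne_zero.mpr (Nat.succ_ne_zero _)
    refine ⟨monomial n (((m * n + 1 : ℕ) : k)⁻¹ * a), ?_⟩
    ext i
    rw [coeff_euler, coeff_monomial, coeff_monomial]
    split_ifs with hi
    · subst hi; rw [mul_inv_cancel_left₀ h]
    · rw [mul_zero]

theorem Lm_eq_zero_iff {f₀ f₁ g₀ g₁ : R k} : Lm k (ofCoord (f₀, f₁, g₀, g₁)) = 0 ↔
    f₁ = 0 ∧ f₀ = sg (pi f₀) + C X * sg g₁ := by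
  rw [Lm_ofCoord, ofCoord_eq_zero_iff]
  constructor
  · rintro ⟨-, -, h, h'⟩
    exact ⟨h', by linear_combination h⟩
  · rintro ⟨h, h'⟩
    exact ⟨by simp [h], rfl, by linear_combination h', h⟩

/-- The kernel of the anticommutator with `x`. -/
theorem exists_of_Lp_eq_zero [CharZero k] {a : A k} (ha : Lp k a = 0) :
    ∃ (h : k[X]) (a' : A k), a = x k * aeval (y k * y k) h + Lm k a' := by
  obtain ⟨f₀, f₁, g₀, g₁, rfl⟩ := exists_ofCoord a
  rw [Lp_ofCoord, ofCoord_eq_zero_iff] at ha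
  obtain ⟨-, -, h1, rfl⟩ := ha
  have h2 := congrArg pi h1
  simp only [map_add, pi_sg, pi_pi, pi_C_X_mul, map_zero, add_zero] at h2
  have h3 : pi f₀ = 0 := by
    have : (2 : R k) * pi f₀ = 0 := by linear_combination h2
    simpa using this
  rw [h3, map_zero, add_zero] at h1
  obtain ⟨h, hh⟩ := exists_emb_eq_pi g₀
  -- Removing `pi g₀` kills the `sg (pi _)` term of `Lm`; the removed part is exactly the
  -- representative in x·k[Y].
  refine ⟨h, ofCoord (g₀ - pi g₀, g₁, 0, 0), ?_⟩
  rw [x_mul_aeval, Lm_ofCoord, ofCoord_add, ofCoord_eq_iff, ← hh]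
  refine ⟨by linear_combination h1, by ring, ?_, by ring⟩
  simp [pi_pi]

/-- The kernel of the commutator with `x`. -/
theorem exists_of_Lm_eq_zero [CharZero k] {a : A k} (ha : Lm k a = 0) :
    ∃ (h : k[X]) (a' : A k), a = aeval (y k * y k + y k * x k) h + Lp k a' := by
  obtain ⟨f₀, f₁, g₀, g₁, rfl⟩ := exists_ofCoord a
  obtain ⟨rfl, h1⟩ := Lm_eq_zero_iff.mp ha
  obtain ⟨h, hh⟩ := exists_emb_eq_pi f₀
  -- The correction by one half inverts f ↦ f + `sg (pi f)`, the third coordinate of `Lp` here.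
  refine ⟨h, ofCoord (g₀ - (2⁻¹ : k) • sg (pi g₀), g₁, 0, 0), ?_⟩
  rw [aeval_z, Lp_ofCoord, ofCoord_add, ofCoord_eq_iff, ← hh]
  refine ⟨h1, by ring, ?_, by ring⟩
  have : pi g₀ - (2⁻¹ : k) • pi g₀ = (2⁻¹ : k) • pi g₀ := by
    rw [sub_eq_iff_eq_add, ← add_smul]; norm_num
  rw [map_sub, pi_smul, pi_sg, pi_pi, this, sg_smul, map_zero]
  ring

/-- At q = 0 the third coordinate of any value of `Lm` vanishes, as `sg` does not change the value
at q = 0. -/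
theorem eq_zero_of_x_mul_aeval_eq_Lm {h : k[X]} {a : A k}
    (ha : x k * aeval (y k * y k) h = Lm k a) : h = 0 := by
  obtain ⟨f₀, f₁, g₀, g₁, rfl⟩ := exists_ofCoord a
  rw [x_mul_aeval, Lm_ofCoord, ofCoord_eq_iff] at ha
  have := congrArg pi ha.2.2.1
  simp only [map_sub, pi_sg, pi_pi, pi_C_X_mul, sub_self, pi_emb] at this
  exact emb_injective (by simpa using this)

theorem eq_zero_of_aeval_eq_Lp {h : k[X]} {a : A k}
    (ha : aeval (y k * y k + y k * x k) h = Lp k a) : h = 0 := by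
  obtain ⟨f₀, f₁, g₀, g₁, rfl⟩ := exists_ofCoord a
  rw [aeval_z, Lp_ofCoord, ofCoord_eq_iff] at ha
  obtain ⟨h1, -, -, h2⟩ := ha
  rw [← h2, map_zero, mul_zero] at h1
  exact emb_injective (by simpa using sg_eq_zero h1)

/-- The algebra is the sum of the image of `E` and the commutant of `x`. -/
theorem exists_E_add [CharZero k] (b : A k) : ∃ b' b'', b = E k b' + b'' ∧ Lm k b'' = 0 := by
  obtain ⟨F₀, F₁, G₀, G₁, rfl⟩ := exists_ofCoord b
  obtain ⟨B, hB⟩ : ∃ B, B = F₀ - C X * sg G₁ := ⟨_, rfl⟩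
  obtain ⟨b₀, hb₀⟩ := exists_emb_eq_pi B
  obtain ⟨b₁, hb₁⟩ := exists_emb_eq_pi (qt B)
  -- Seek b' = (f₀, p, g, 0) with p in k[Y]. Membership of b - `E b'` in the commutant of x then
  -- reads B = 2Yp + sg h + q sg p - q² d/dY (sg g) for some h in k[Y]. The terms of order 0 and 1
  -- in q are b₀ = 2Yp + h and b₁ = h' + p; eliminating h leaves p + 2Yp' = b₀' - b₁.
  obtain ⟨p, hp⟩ := euler_surjective 2 (derivative b₀ - b₁)
  obtain ⟨h, hh⟩ : ∃ h, h = b₀ - 2 * X * p := ⟨_, rfl⟩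
  have hd : pi (qt B - sg (emb p) - derivative (sg (emb h))) = 0 := by
    rw [map_sub, map_sub, pi_sg, pi_derivative, pi_sg, pi_emb, pi_emb, derivative_emb, hb₁, hh,
      ← map_sub, ← map_sub, ← map_zero emb]
    congr 1
    push_cast at hp
    simp only [derivative_sub, derivative_mul, derivative_X, derivative_ofNat]
    linear_combination hp
  have hd' := exists_of_pi_eq_zero hd
  -- All terms of order at least 2 in q are absorbed by g, through one integration in Y.
  obtain ⟨g, hg⟩ := exists_derivative_sg (- qt (qt B - sg (emb p) - derivative (sg (emb h))))
  have hpi : pi (F₁ - (2⁻¹ : k) • pi F₁) = (2⁻¹ : k) • pi F₁ := by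
    rw [map_sub, pi_smul, pi_pi, sub_eq_iff_eq_add, ← add_smul]; norm_num
  refine ⟨ofCoord (F₁ - (2⁻¹ : k) • pi F₁, emb p, g, 0),
    ofCoord (sg (emb h) + C X * sg (G₁ - g + emb p), 0,
      G₀ - (zh (qt (F₁ - (2⁻¹ : k) • pi F₁)) - (F₁ - (2⁻¹ : k) • pi F₁)), G₁ - g + emb p), ?_, ?_⟩
  · rw [E_ofCoord, ofCoord_add, ofCoord_eq_iff, pi_emb, hpi]
    have hq : qt (emb p) = 0 := by rw [← pi_emb, qt_pi]
    refine ⟨?_, by ring, by ring, by rw [hq, map_zero]; ring⟩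
    have e1 := sg_eq g
    rw [hg] at e1
    have e2 := sg_eq (emb h)
    have e3 := pi_add_qt B
    have e4 := congrArg emb hh
    simp only [map_sub, map_mul, emb_X, map_ofNat] at e4
    rw [map_add, map_sub]
    linear_combination -hB - e3 + hb₀ + C X * hd' - e4 + C X * e1 - e2
  · rw [Lm_eq_zero_iff]
    refine ⟨rfl, ?_⟩
    simp only [map_add, pi_sg, pi_C_X_mul, pi_emb, add_zero]

/-- The commutator with `y` on the commutant of `x`. -/
theorem Dy_commutant (h : k[X]) (e₀ e₁ : R k) :
    Lm k (ofCoord (sg (emb h) + C X * sg e₁, 0, e₀, e₁)) = 0 ∧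
    Dy k (ofCoord (sg (emb h) + C X * sg e₁, 0, e₀, e₁)) =
      ofCoord (C X * e₀, -(C X * (derivative (sg (emb h)) + C X * derivative (sg e₁))),
        zh (derivative (sg (emb h)) + sg e₁) - X * e₁, - e₀) := by
  have hpi : pi (sg (emb h) + C X * sg e₁) = emb h := by
    simp only [map_add, pi_sg, pi_C_X_mul, pi_emb, add_zero]
  have hqt : qt (sg (emb h) + C X * sg e₁) = derivative (sg (emb h)) + sg e₁ := by
    have : sg (emb h) + C X * sg e₁ = pi (emb h) + C X * (derivative (sg (emb h)) + sg e₁) := by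
      rw [pi_emb]; linear_combination sg_eq (emb h)
    rw [this, map_add, qt_pi, qt_C_X_mul, zero_add]
  constructor
  · exact Lm_eq_zero_iff.mpr ⟨rfl, by rw [hpi]⟩
  · rw [Dy_ofCoord, hpi, hqt, ofCoord_eq_iff]
    simp only [map_zero]
    refine ⟨by ring, ?_, trivial, by ring⟩
    linear_combination -sg_eq (emb h) - C X * sg_eq e₁

theorem qD_C (r : k[X]) : qD (C r) = C (X ^ 2 * derivative r) := by
  have := coeffwise_C_mul_X_pow (LinearMap.mulLeft k (X ^ 2) ∘ₗ derivative) r 0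
  simpa [qD] using this

theorem exists_C_of_derivative_sg [CharZero k] {g : R k} (h : derivative (sg g) = 0) :
    ∃ p, g = C p ∧ sg g = C p := by
  have h1 := sg_eq g
  rw [h, mul_zero, add_zero] at h1
  rw [h1] at h
  exact ⟨_, eq_C_of_derivative_eq_zero h, h1.trans (eq_C_of_derivative_eq_zero h)⟩

theorem sg_C (r : k[X]) : sg (C r : R k) = C r := by
  have h := sg_C_mul r (X ^ 0)
  rw [sg_X_pow] at h
  simpa [zeta] using h

/-- An Euler operator forces f₁ to vanish at q = 0. An element of the commutant of x is then chosen
whose commutator with y matches every coordinate of b but the third. The remaining third coordinate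
is a polynomial in q alone: its constant term is the multiple of x, and the rest is again a
commutator with y. This is the uniqueness of the class `c` up to scalars and the `s` family. -/
theorem exists_of_Lm_E_eq_zero [CharZero k] {b : A k} (hb : Lm k (E k b) = 0) :
    ∃ (r : k) (a : A k), Lm k a = 0 ∧ b = r • x k + Dy k a := by
  obtain ⟨f₀, f₁, g₀, g₁, rfl⟩ := exists_ofCoord b
  have hE := hb
  rw [E_ofCoord, Lm_eq_zero_iff] at hE
  obtain ⟨h1, h2⟩ := hE
  have h3 := congrArg pi h1
  simp only [map_add, pi_pi, pi_C_X_mul, map_zero, add_zero] at h3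
  have hf₀ : pi f₀ = 0 := by
    have : (2 : R k) * pi f₀ = 0 := by linear_combination h3
    simpa using this
  obtain ⟨p, hp⟩ := exists_emb_eq_pi f₁
  have hf₁ := pi_add_qt f₁
  have h4 : g₀ + qt f₁ * X = derivative (sg (2 * X * pi f₁)) +
      sg (zh (qt f₁) + g₀ - f₁) := by
    apply C_X_mul_cancel
    have e : pi (X * pi f₁ + C X * g₀ + X * f₁) = 2 * X * pi f₁ := by
      simp only [map_add, map_mul, pi_X, pi_pi, pi_C_X]; ring
    rw [e] at h2
    linear_combination h2 + sg_eq (2 * X * pi f₁) + X * hf₁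
  have h5 := congrArg pi h4
  simp only [map_add, pi_sg, pi_derivative, map_sub, map_mul, pi_X, pi_zh, pi_pi] at h5
  rw [hp] at h5
  -- At q = 0 the condition reads 0 = p + 2Yp', which has only the zero solution.
  have hp0 : p = 0 := by
    apply euler_injective 2
    apply emb_injective
    have e : derivative (pi (2 : R k) * X * emb p) = 2 * emb p + 2 * X * emb (derivative p) := by
      rw [map_ofNat, derivative_mul, derivative_mul, derivative_X, derivative_emb]
      simp
    rw [e] at h5
    simp only [map_add, map_mul, map_natCast, emb_X, map_zero]
    push_cast
    linear_combination -h5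
  rw [hp0, map_zero] at hp
  rw [hp, zero_add] at hf₁
  obtain ⟨p₁, hp₁⟩ := exists_emb_eq_pi (qt f₁)
  obtain ⟨h, hh⟩ := exists_derivative_eq (k := k) (-p₁)
  have hd : pi (qt f₁ + derivative (sg (emb h))) = 0 := by
    rw [map_add, pi_derivative, pi_sg, pi_emb, derivative_emb, hh, hp₁, map_neg, add_neg_cancel]
  obtain ⟨e₁, he₁⟩ := exists_derivative_sg (-qt (qt f₁ + derivative (sg (emb h))))
  have hd' := exists_of_pi_eq_zero hd
  obtain ⟨hL, hD⟩ := Dy_commutant h (-g₁) e₁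
  obtain ⟨g', hg'⟩ : ∃ g', g' = g₀ - (zh (derivative (sg (emb h)) + sg e₁) - X * e₁) := ⟨_, rfl⟩
  obtain ⟨a₁, ha₁⟩ : ∃ a₁, a₁ = ofCoord (sg (emb h) + C X * sg e₁, 0, -g₁, e₁) := ⟨_, rfl⟩
  rw [← ha₁] at hL hD
  have hb' : ofCoord (f₀, f₁, g₀, g₁) = ofCoord (0, 0, g', 0) + Dy k a₁ := by
    rw [hD, ofCoord_add, ofCoord_eq_iff, he₁]
    refine ⟨?_, ?_, by rw [hg']; ring, by ring⟩
    · linear_combination h1 - hf₀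
    · linear_combination -hf₁ + C X * hd'
  rw [hb', map_add, map_add, Lm_E_Dy hL, add_zero, E_ofCoord, Lm_eq_zero_iff] at hb
  have h6 := hb.2
  simp only [map_zero, mul_zero, zero_add, add_zero, sub_zero, pi_C_X_mul] at h6
  have h7 : derivative (sg g') = 0 := by
    apply C_X_mul_cancel
    have h6' := C_X_mul_cancel h6
    linear_combination -h6' - sg_eq g'
  obtain ⟨r, hr, -⟩ := exists_C_of_derivative_sg h7
  -- Bracketing with y sends the commutant element with coordinates (q r', 0, 0, r') to third
  -- coordinate q(r' + q dr'/dq), so any r without constant term is reached.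
  obtain ⟨r', hr'⟩ := euler_surjective 1 r.divX
  obtain ⟨hL', hD'⟩ := Dy_commutant 0 0 (C r')
  refine ⟨r.coeff 0, a₁ + ofCoord (sg (emb 0) + C X * sg (C r'), 0, 0, C r'),
    by rw [map_add, hL, hL', add_zero], ?_⟩
  rw [hb', map_add, hD', add_comm (Dy k a₁), ← add_assoc]
  congr 1
  have hx : r.coeff 0 • x k = ofCoord (0, 0, C (C (r.coeff 0)), 0) := by
    have := x_mul_aeval (C (r.coeff 0))
    rw [aeval_C, ← Algebra.commutes, ← Algebra.smul_def] at this
    rw [this]; simp [emb]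
  rw [hx, ofCoord_add, ofCoord_eq_iff]
  simp only [map_zero, zero_add, sg_C, zh_apply, qD_C, derivative_C, mul_zero,
    neg_zero, add_zero, true_and, and_true, hr]
  have h8 := divX_mul_X_add r
  rw [← hr'] at h8
  rw [Nat.cast_one, one_mul] at h8
  have h9 := congrArg (C : k[X] → R k) h8
  simp only [C_add, C_mul, C_pow] at h9 ⊢
  linear_combination -h9

theorem eq_zero_of_smul_x_eq_Dy {r : k} {a : A k} (h : r • x k = Dy k a) : r = 0 := by
  obtain ⟨f₀, f₁, g₀, g₁, rfl⟩ := exists_ofCoord a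
  have hx : r • x k = ofCoord (0, 0, C (C r), 0) := by
    have := x_mul_aeval (C r)
    rw [aeval_C, ← Algebra.commutes, ← Algebra.smul_def] at this
    rw [this]; simp [emb]
  rw [hx, Dy_ofCoord, ofCoord_eq_iff] at h
  have h1 := congrArg pi h.2.2.1
  rw [map_sub, map_mul, pi_zh, pi_X] at h1
  simpa [pi] using congrArg (coeff · 0) h1

/-- Commuting with x puts a in the form treated by `Dy_commutant`. Commuting with y then forces h' =
0, e₀ = 0, and e₁ = r(q) with r + q dr/dq = 0, hence r = 0. -/
theorem center_eq_bot [CharZero k] : Subalgebra.center k (A k) = ⊥ := by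
  rw [eq_bot_iff]
  intro a ha
  rw [Subalgebra.mem_center_iff] at ha
  have hL : Lm k a = 0 := by rw [Lm_apply, ha, sub_self]
  have hD : Dy k a = 0 := by rw [Dy_apply, ha, sub_self]
  obtain ⟨f₀, f₁, e₀, e₁, rfl⟩ := exists_ofCoord a
  obtain ⟨rfl, h1⟩ := Lm_eq_zero_iff.mp hL
  obtain ⟨h, hh⟩ := exists_emb_eq_pi f₀
  rw [hh] at h1
  subst h1
  rw [(Dy_commutant h e₀ e₁).2, ofCoord_eq_zero_iff] at hD
  obtain ⟨-, h2, h3, h4⟩ := hD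
  have h5 : derivative (sg (emb h)) + C X * derivative (sg e₁) = 0 :=
    C_X_mul_cancel (by linear_combination -h2)
  have h6 := congrArg pi h5
  simp only [map_add, pi_derivative, pi_sg, pi_emb, pi_C_X_mul, add_zero, map_zero] at h6
  rw [derivative_emb] at h6
  have h7 : derivative h = 0 := emb_injective (by simpa using h6)
  rw [eq_C_of_derivative_eq_zero h7] at h5 h3 ⊢
  have h8 (r : k) : emb (C r) = C (C r) := by simp [emb]
  simp only [h8, sg_C, derivative_C, zero_add] at h5 h3 ⊢
  obtain ⟨r, hr, hr'⟩ := exists_C_of_derivative_sg (C_X_mul_cancel (by linear_combination h5) :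
    derivative (sg e₁) = 0)
  rw [hr', hr, zh_apply, qD_C] at h3
  have hr0 : r = 0 := by
    apply euler_injective 1
    have h9 : (C (X * (r + ((1 : ℕ) : k[X]) * (X * derivative r))) : R k) = C 0 := by
      simp only [C_mul, C_add, C_pow, map_natCast, map_zero] at h3 ⊢
      rw [Nat.cast_one]
      linear_combination h3
    simpa using C_injective h9
  have h10 : e₀ = 0 := by linear_combination -h4
  rw [hr', hr, hr0, h10, Algebra.mem_bot]
  refine ⟨h.coeff 0, ?_⟩
  have := nf_emb (C (h.coeff 0))
  rw [h8, aeval_C] at this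
  simp [ofCoord_mk, this]

end Commutators

end SuperJordanPlane

namespace SuperJordanPlane

/-! ### Cocycles modulo coboundaries on pairs. -/

section Cohomology

open Polynomial

variable {k : Type u} [Field k]

theorem derivative_sg (f : R k) : derivative (sg f) = sg (derivative f) := by
  have h := sg_sub (derivative (sg f))
  have e : sg f - C X * derivative (sg f) = f := by linear_combination sg_eq f
  rw [← derivative_C_X_mul, ← derivative_sub, e] at h
  exact h.symm

theorem qt_emb (h : k[X]) : qt (emb h) = 0 := by
  rw [← pi_emb, qt_pi]

theorem y_mul_aeval (h : k[X]) : y k * aeval (y k * y k) h = ofCoord (0, emb h, 0, 0) := by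
  rw [← nf_emb, y_mul_nf, pi_emb, qt_emb]
  simp [ofCoord_mk]

theorem x_mul_y_mul_aeval (h : k[X]) :
    x k * (y k * aeval (y k * y k) h) = ofCoord (0, 0, 0, emb h) := by
  rw [y_mul_aeval, x_mul_ofCoord]

/-- This dictates the second entry -y²ⁿ⁺¹ of the cocycles `u`. The proof uses xyq = 0 and the fact
that Y + q commutes with polynomials in itself. -/
theorem T_aeval_z (h : k[X]) : T k (aeval (y k * y k + y k * x k) h) =
    -Lp k (y k * aeval (y k * y k) h) := by
  have hxy : x k * y k * nf (sg (emb h)) = x k * y k * nf (emb h) := by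
    have e : sg (emb h) = emb h + C X * derivative (sg (emb h)) := sg_eq _
    rw [e, map_add, mul_add, nf_C_X_mul]
    have : x k * y k * (y k * x k * nf (derivative (sg (emb h)))) = 0 := by
      simp only [mul_assoc, y_mul_y_mul_x_mul, mul_add, x_mul_x', add_zero]
    rw [this, add_zero]
  have hc := congrArg (aeval (y k * y k + y k * x k)) (mul_comm X h)
  rw [map_mul, map_mul, aeval_X, ← nf_sg_emb] at hc
  have hx : y k * nf (emb h) * x k = y k * x k * nf (sg (emb h)) := by
    rw [mul_assoc, nf_mul_x, pi_emb, mul_assoc]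
  rw [← nf_sg_emb, ← nf_emb, T_apply, Lp_apply, hx, ← mul_assoc (x k), ← hxy]
  rw [add_mul, mul_add] at hc
  rw [sub_sub, ← hc]
  abel

theorem T_x_mul_aeval (h : k[X]) : T k (x k * aeval (y k * y k) h) =
    Lm k (x k * (y k * aeval (y k * y k) h)) := by
  have hc := congrArg (aeval (y k * y k)) (mul_comm X h)
  rw [map_mul, map_mul, aeval_X, ← nf_emb] at hc
  have hL : Lm k (x k * (y k * nf (emb h))) = - (x k * (y k * x k * nf (sg (emb h)))) := by
    rw [nf_emb, x_mul_y_mul_aeval, Lm_ofCoord]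
    simp [ofCoord_mk, nf_C_X_mul]
  rw [← nf_emb, hL, T_apply, ← nf_mul_q, mul_assoc (x k) (nf _) (y k * y k), ← hc]
  simp only [mul_assoc, y_mul_y_mul_x_mul]
  abel

theorem Lp_x_mul_aeval (h : k[X]) : Lp k (x k * aeval (y k * y k) h) = 0 := by
  rw [x_mul_aeval, Lp_ofCoord, ofCoord_eq_zero_iff]
  simp

theorem Lm_aeval_z (h : k[X]) : Lm k (aeval (y k * y k + y k * x k) h) = 0 := by
  rw [aeval_z, Lm_eq_zero_iff]
  simp [pi_sg, pi_emb]

/-- The degree 1 analogue of `T_x_mul_aeval`: the operator `E` applied to y·h(Y) produces the Euler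
operator, so that (x(h + 2Yh'), y·h) is a cocycle. -/
theorem T_x_mul_aeval_euler (h : k[X]) :
    T k (x k * aeval (y k * y k) (h + ((2 : ℕ) : k[X]) * (X * derivative h))) =
      Lm k (E k (y k * aeval (y k * y k) h)) := by
  rw [T_x_mul_aeval, x_mul_y_mul_aeval, y_mul_aeval, E_ofCoord, Lm_ofCoord, Lm_ofCoord,
    ofCoord_eq_iff]
  have h1 := sg_eq (X * emb h)
  rw [derivative_sg, derivative_mul, derivative_X, one_mul, derivative_emb] at h1
  simp only [map_zero, mul_zero, add_zero, pi_emb, qt_emb, sub_zero, neg_zero, zero_sub,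
    map_mul, map_natCast, emb_X, map_neg, true_and, and_true, map_add emb, map_add sg] at h1 ⊢
  have h2 : pi (X * emb h + X * emb h) = X * emb h + X * emb h := by
    simp only [map_add, map_mul, pi_X, pi_emb]
  rw [Nat.cast_two, two_mul (X * emb _), h2, map_add sg (X * emb h), map_add sg (X * emb (derivative h))]
  linear_combination 2 * h1

variable (k)

/-- The differential from degree `0` to degree `1`. -/
noncomputable def d0 : A k →ₗ[k] A k × A k := (Lm k).prod (Dy k)

/-- The differential from degree `1` to degree `2`. -/
noncomputable def d1 : A k × A k →ₗ[k] A k × A k :=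
  (Lp k ∘ₗ LinearMap.fst k _ _).prod
    (T k ∘ₗ LinearMap.fst k _ _ - Lm k ∘ₗ E k ∘ₗ LinearMap.snd k _ _)

/-- The differential from an odd degree greater than `1`. -/
noncomputable def dOdd : A k × A k →ₗ[k] A k × A k :=
  (Lp k ∘ₗ LinearMap.fst k _ _).prod (T k ∘ₗ LinearMap.fst k _ _ - Lm k ∘ₗ LinearMap.snd k _ _)

/-- The differential from a positive even degree. -/
noncomputable def dEven : A k × A k →ₗ[k] A k × A k :=
  (Lm k ∘ₗ LinearMap.fst k _ _).prod (T k ∘ₗ LinearMap.fst k _ _ - Lp k ∘ₗ LinearMap.snd k _ _)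

variable {k}

theorem d0_apply (a : A k) : d0 k a = (Lm k a, Dy k a) := rfl
theorem d1_apply (a b : A k) : d1 k (a, b) = (Lp k a, T k a - Lm k (E k b)) := rfl
theorem dOdd_apply (a b : A k) : dOdd k (a, b) = (Lp k a, T k a - Lm k b) := rfl
theorem dEven_apply (a b : A k) : dEven k (a, b) = (Lm k a, T k a - Lp k b) := rfl

variable (k)

noncomputable def aevalY : k[X] →ₗ[k] A k := (aeval (y k * y k) : k[X] →ₐ[k] A k).toLinearMap
noncomputable def aevalZ : k[X] →ₗ[k] A k :=
  (aeval (y k * y k + y k * x k) : k[X] →ₐ[k] A k).toLinearMap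

/-- The space spanned by the cocycles `c` and `s n`. -/
noncomputable def repOne : k × k[X] →ₗ[k] A k × A k :=
  (LinearMap.mulLeft k (x k) ∘ₗ aevalY k ∘ₗ
    (LinearMap.id + (2 : ℕ) • (LinearMap.mulLeft k X ∘ₗ derivative)) ∘ₗ LinearMap.snd k _ _).prod
  ((LinearMap.toSpanSingleton k _ (x k)) ∘ₗ LinearMap.fst k _ _ +
    LinearMap.mulLeft k (y k) ∘ₗ aevalY k ∘ₗ LinearMap.snd k _ _)

/-- The space spanned by the cocycles `t n` and `u n`. -/
noncomputable def repEven : k[X] × k[X] →ₗ[k] A k × A k :=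
  (aevalZ k ∘ₗ LinearMap.snd k _ _).prod
    (LinearMap.mulLeft k (x k) ∘ₗ aevalY k ∘ₗ LinearMap.fst k _ _ -
      LinearMap.mulLeft k (y k) ∘ₗ aevalY k ∘ₗ LinearMap.snd k _ _)

/-- The space spanned by the cocycles `v n` and `w n`. -/
noncomputable def repOdd : k[X] × k[X] →ₗ[k] A k × A k :=
  (LinearMap.mulLeft k (x k) ∘ₗ aevalY k ∘ₗ LinearMap.snd k _ _).prod
    (aevalZ k ∘ₗ LinearMap.fst k _ _ +
      LinearMap.mulLeft k (x k) ∘ₗ LinearMap.mulLeft k (y k) ∘ₗ aevalY k ∘ₗ LinearMap.snd k _ _)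

variable {k}

theorem repOne_apply (r : k) (h : k[X]) : repOne k (r, h) =
    (x k * aeval (y k * y k) (h + ((2 : ℕ) : k[X]) * (X * derivative h)),
      r • x k + y k * aeval (y k * y k) h) := by
  rw [← nsmul_eq_mul]
  rfl

theorem repEven_apply (h h' : k[X]) : repEven k (h, h') =
    (aeval (y k * y k + y k * x k) h',
      x k * aeval (y k * y k) h - y k * aeval (y k * y k) h') := rfl

theorem repOdd_apply (h h' : k[X]) : repOdd k (h, h') =
    (x k * aeval (y k * y k) h',
      aeval (y k * y k + y k * x k) h + x k * (y k * aeval (y k * y k) h')) := rfl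

theorem Lm_E_x : Lm k (E k (x k)) = 0 := by
  simp only [Lm_apply, E_apply, mul_sub, sub_mul, mul_add, add_mul, mul_assoc, x_mul_x, x_mul_x',
    mul_zero, zero_mul]
  abel

theorem d1_repOne (v : k × k[X]) : d1 k (repOne k v) = 0 := by
  obtain ⟨r, h⟩ := v
  rw [repOne_apply, d1_apply, Lp_x_mul_aeval, T_x_mul_aeval_euler, map_add, map_add, map_smul,
    map_smul, Lm_E_x, smul_zero, zero_add, sub_self, Prod.mk_zero_zero]

theorem dEven_repEven (v : k[X] × k[X]) : dEven k (repEven k v) = 0 := by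
  obtain ⟨h, h'⟩ := v
  rw [repEven_apply, dEven_apply, Lm_aeval_z, T_aeval_z, map_sub, Lp_x_mul_aeval, zero_sub,
    sub_self, Prod.mk_zero_zero]

theorem dOdd_repOdd (v : k[X] × k[X]) : dOdd k (repOdd k v) = 0 := by
  obtain ⟨h, h'⟩ := v
  rw [repOdd_apply, dOdd_apply, Lp_x_mul_aeval, T_x_mul_aeval, map_add, Lm_aeval_z, zero_add,
    sub_self, Prod.mk_zero_zero]

theorem eq_zero_of_repOne_eq_d0 [CharZero k] {v : k × k[X]} {a : A k} (h : repOne k v = d0 k a) :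
    v = 0 := by
  obtain ⟨r, g⟩ := v
  rw [repOne_apply, d0_apply, Prod.mk.injEq] at h
  obtain ⟨h1, h2⟩ := h
  have hg := euler_injective 2 (eq_zero_of_x_mul_aeval_eq_Lm h1)
  rw [hg, map_zero, mul_zero, add_zero] at h2
  rw [hg, eq_zero_of_smul_x_eq_Dy h2, Prod.mk_zero_zero]

/-- The kernel of `Lp` normalises the first entry. After subtracting a lift of it and a coboundary,
the second entry lies in the kernel of `Lm ∘ E`; the leftover commutator with y comes from the
commutant of x, so it leaves the first entry unchanged. -/
theorem exists_repOne_add_d0 [CharZero k] {p : A k × A k} (hp : d1 k p = 0) :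
    ∃ v a, p = repOne k v + d0 k a := by
  obtain ⟨a, b⟩ := p
  rw [d1_apply, Prod.mk_eq_zero] at hp
  obtain ⟨h, a', rfl⟩ := exists_of_Lp_eq_zero hp.1
  obtain ⟨g, rfl⟩ := euler_surjective 2 h
  have hb : Lm k (E k (b - y k * aeval (y k * y k) g - Dy k a')) = 0 := by
    have hd := hp.2
    rw [map_add, T_x_mul_aeval_euler, T_Lm] at hd
    have h1 : Lm k (T k a') = Lm k (E k (Dy k a')) := by
      simp only [T_apply, E_apply, Dy_apply, Lm_apply, mul_sub, sub_mul, mul_add, add_mul,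
        mul_assoc, x_mul_x, x_mul_x', mul_zero]
      abel
    rw [h1] at hd
    simp only [map_sub]
    rw [← neg_eq_zero, ← hd]
    abel
  obtain ⟨r, a'', h1, h2⟩ := exists_of_Lm_E_eq_zero hb
  refine ⟨(r, g), a' + a'', ?_⟩
  rw [repOne_apply, d0_apply, Prod.mk_add_mk, map_add, map_add, h1, add_zero]
  congr 1
  rw [sub_eq_iff_eq_add, sub_eq_iff_eq_add] at h2
  rw [h2, map_add]
  abel

theorem eq_zero_of_repOdd_eq_dEven {v : k[X] × k[X]} {p : A k × A k}
    (h : repOdd k v = dEven k p) [CharZero k] : v = 0 := by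
  obtain ⟨g, g'⟩ := v
  obtain ⟨a, b⟩ := p
  rw [repOdd_apply, dEven_apply, Prod.mk.injEq] at h
  obtain ⟨h1, h2⟩ := h
  have hg := eq_zero_of_x_mul_aeval_eq_Lm h1
  rw [hg, map_zero, mul_zero, eq_comm] at h1
  obtain ⟨h', a', rfl⟩ := exists_of_Lm_eq_zero h1
  rw [hg, map_zero, mul_zero, mul_zero, add_zero, map_add, T_aeval_z, T_Lp, ← map_neg, ← map_add,
    ← map_sub] at h2
  rw [hg, eq_zero_of_aeval_eq_Lp h2, Prod.mk_zero_zero]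

theorem exists_repOdd_add_dEven [CharZero k] {p : A k × A k} (hp : dOdd k p = 0) :
    ∃ v q, p = repOdd k v + dEven k q := by
  obtain ⟨a, b⟩ := p
  rw [dOdd_apply, Prod.mk_eq_zero] at hp
  obtain ⟨hp1, hp2⟩ := hp
  obtain ⟨h, a', rfl⟩ := exists_of_Lp_eq_zero hp1
  have hb : Lm k (b - x k * (y k * aeval (y k * y k) h) - T k a') = 0 := by
    rw [map_add, T_Lm, T_x_mul_aeval] at hp2
    rw [map_sub, map_sub, ← neg_eq_zero, ← hp2]
    abel
  obtain ⟨h', b', hb'⟩ := exists_of_Lm_eq_zero hb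
  refine ⟨(h', h), (a', -b'), ?_⟩
  rw [repOdd_apply, dEven_apply, Prod.mk_add_mk, map_neg, sub_neg_eq_add]
  congr 1
  rw [sub_eq_iff_eq_add, sub_eq_iff_eq_add] at hb'
  rw [hb']
  abel

theorem eq_zero_of_repEven_eq_dOdd [CharZero k] {v : k[X] × k[X]} {p : A k × A k}
    (h : repEven k v = dOdd k p) : v = 0 := by
  obtain ⟨g, g'⟩ := v
  obtain ⟨a, b⟩ := p
  rw [repEven_apply, dOdd_apply, Prod.mk.injEq] at h
  obtain ⟨h1, h2⟩ := h
  have hg := eq_zero_of_aeval_eq_Lp h1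
  rw [hg, map_zero, eq_comm] at h1
  obtain ⟨h', a', rfl⟩ := exists_of_Lp_eq_zero h1
  rw [hg, map_zero, mul_zero, sub_zero, map_add, T_x_mul_aeval, T_Lm, ← map_add,
    ← map_sub] at h2
  rw [hg, eq_zero_of_x_mul_aeval_eq_Lm h2, Prod.mk_zero_zero]

theorem exists_repEven_add [CharZero k] {p : A k × A k} (hp : dEven k p = 0) :
    ∃ v a b, p = repEven k v + (Lp k a, T k a - Lm k b) := by
  obtain ⟨a, b⟩ := p
  rw [dEven_apply, Prod.mk_eq_zero] at hp
  obtain ⟨hp1, hp2⟩ := hp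
  obtain ⟨h, a', rfl⟩ := exists_of_Lm_eq_zero hp1
  have hb : Lp k (b + y k * aeval (y k * y k) h - T k a') = 0 := by
    rw [map_add, T_Lp, T_aeval_z] at hp2
    rw [map_sub, map_add, ← neg_eq_zero, ← hp2]
    abel
  obtain ⟨h', b', hb'⟩ := exists_of_Lp_eq_zero hb
  refine ⟨(h', h), a', -b', ?_⟩
  rw [repEven_apply, Prod.mk_add_mk, map_neg, sub_neg_eq_add]
  congr 1
  rw [sub_eq_iff_eq_add] at hb'
  rw [← add_sub_cancel_right b (y k * aeval (y k * y k) h), hb']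
  abel

theorem exists_repEven_add_dOdd [CharZero k] {p : A k × A k} (hp : dEven k p = 0) :
    ∃ v q, p = repEven k v + dOdd k q :=
  let ⟨v, a, b, h⟩ := exists_repEven_add hp
  ⟨v, (a, b), h⟩

/-- Because A is the image of `E` plus the commutant of x, `Lm ∘ E` and `Lm` have the same image, so
degree 2 behaves like the higher even degrees. -/
theorem exists_repEven_add_d1 [CharZero k] {p : A k × A k} (hp : dEven k p = 0) :
    ∃ v q, p = repEven k v + d1 k q := by
  obtain ⟨v, a, b, h⟩ := exists_repEven_add hp
  obtain ⟨b', b'', rfl, hb⟩ := exists_E_add b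
  refine ⟨v, (a, b'), ?_⟩
  rw [h, d1_apply, map_add, hb, add_zero]

theorem eq_zero_of_repEven_eq_d1 [CharZero k] {v : k[X] × k[X]} {p : A k × A k}
    (h : repEven k v = d1 k p) : v = 0 :=
  eq_zero_of_repEven_eq_dOdd (p := (p.1, E k p.2)) h

end Cohomology

end SuperJordanPlane

namespace SuperJordanPlane

/-! ### Exactness of the bimodule complex. -/

section Exactness

variable {k : Type u} [Field k]

theorem ten_smul_left (r : k) (a b : A k) : ten (r • a) b = r • ten a b :=
  TensorProduct.smul_tmul' r a (op b)

theorem ten_smul_right (r : k) (a b : A k) : ten a (r • b) = r • ten a b :=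
  TensorProduct.tmul_smul r a (op b)

/-- The linear map on `Aᵉ` given by a bilinear map. -/
noncomputable def liftAe {N : Type*} [AddCommGroup N] [Module k N] (B : A k →ₗ[k] A k →ₗ[k] N) :
    Ae k →ₗ[k] N :=
  (TensorProduct.lift (B.compl₂ (opLinearEquiv k).symm.toLinearMap) : A k ⊗[k] (A k)ᵐᵒᵖ →ₗ[k] N)

theorem liftAe_ten {N : Type*} [AddCommGroup N] [Module k N] (B : A k →ₗ[k] A k →ₗ[k] N)
    (a b : A k) : liftAe B (ten a b) = B a b := rfl

theorem Ae_induction {motive : Ae k → Prop} (p : Ae k) (zero : motive 0)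
    (add : ∀ p q, motive p → motive q → motive (p + q)) (ten : ∀ a b, motive (ten a b)) :
    motive p :=
  TensorProduct.induction_on (motive := motive) p zero (fun a b => ten a b.unop) add

theorem P_induction {n : ℕ} {motive : P k n → Prop} (p : P k n) (zero : motive 0)
    (add : ∀ p q, motive p → motive q → motive (p + q)) (el : ∀ a w b, motive (el a w b)) :
    motive p := by
  induction p using Finsupp.induction_linear with
  | zero => exact zero
  | add p q hp hq => exact add p q hp hq
  | single w p =>
    induction p using Ae_induction with
    | zero => simpa using zero
    | add p q hp hq => rw [Finsupp.single_add]; exact add _ _ hp hq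
    | ten a b => exact el a w b

/-- The map `(a, b) ↦ a ⊗ w ⊗ b`. -/
noncomputable def elL {n : ℕ} (w : Cell n) : A k →ₗ[k] A k →ₗ[k] P k n :=
  LinearMap.mk₂ k (fun a b => el a w b) (fun a a' b => el_add_left k a a' b w)
    (fun r a b => by rw [el, ten_smul_left, ← Finsupp.smul_single]; rfl)
    (fun a b b' => el_add_right k a b b' w)
    (fun r a b => by rw [el, ten_smul_right, ← Finsupp.smul_single]; rfl)

theorem elL_apply {n : ℕ} (w : Cell n) (a b : A k) : elL w a b = el a w b := rfl

/-- The linear map on a free bimodule given by a bilinear map for each generator. -/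
noncomputable def liftP {n : ℕ} {N : Type*} [AddCommGroup N] [Module k N]
    (B : Cell n → A k →ₗ[k] A k →ₗ[k] N) : P k n →ₗ[k] N :=
  Finsupp.lsum k fun w => liftAe (B w)

theorem liftP_el {n : ℕ} {N : Type*} [AddCommGroup N] [Module k N]
    (B : Cell n → A k →ₗ[k] A k →ₗ[k] N) (a : A k) (w : Cell n) (b : A k) :
    liftP B (el a w b) = B w a b := by
  rw [liftP, el, Finsupp.lsum_single, liftAe_ten]

variable (k) in
/-- The coefficient of `x` on the left: `f + x * g ↦ g`. -/
noncomputable def nu : A k →ₗ[k] A k :=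
  ofCoord ∘ₗ (LinearMap.prod (LinearMap.fst k _ _ ∘ₗ LinearMap.snd k _ _ ∘ₗ LinearMap.snd k _ _)
    (LinearMap.prod (LinearMap.snd k _ _ ∘ₗ LinearMap.snd k _ _ ∘ₗ LinearMap.snd k _ _) 0)) ∘ₗ
  (coordEquiv k).symm.toLinearMap

variable (k) in
/-- The coefficient of `yx` on the left. -/
noncomputable def kappa : A k →ₗ[k] A k :=
  ofCoord ∘ₗ (LinearMap.prod (qt ∘ₗ LinearMap.fst k _ _)
    (LinearMap.prod (qt ∘ₗ LinearMap.fst k _ _ ∘ₗ LinearMap.snd k _ _) 0)) ∘ₗ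
  (coordEquiv k).symm.toLinearMap

theorem coordEquiv_symm_ofCoord (a : Coord k) : (coordEquiv k).symm (ofCoord a) = a :=
  (coordEquiv k).symm_apply_apply a

theorem nu_ofCoord (f₀ f₁ g₀ g₁ : R k) :
    nu k (ofCoord (f₀, f₁, g₀, g₁)) = ofCoord (g₀, g₁, 0, 0) := by
  simp only [nu, LinearMap.comp_apply, LinearEquiv.coe_coe, coordEquiv_symm_ofCoord]
  rfl

theorem kappa_ofCoord (f₀ f₁ g₀ g₁ : R k) :
    kappa k (ofCoord (f₀, f₁, g₀, g₁)) = ofCoord (qt f₀, qt f₁, 0, 0) := by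
  simp only [kappa, LinearMap.comp_apply, LinearEquiv.coe_coe, coordEquiv_symm_ofCoord]
  rfl

theorem nu_nu (a : A k) : nu k (nu k a) = 0 := by
  obtain ⟨f₀, f₁, g₀, g₁, rfl⟩ := exists_ofCoord a
  rw [nu_ofCoord, nu_ofCoord]
  exact map_zero ofCoord

theorem nu_x_mul (a : A k) : nu k (x k * a) = a - x k * nu k a := by
  obtain ⟨f₀, f₁, g₀, g₁, rfl⟩ := exists_ofCoord a
  rw [x_mul_ofCoord, nu_ofCoord, nu_ofCoord, x_mul_ofCoord, ofCoord_sub]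
  simp only [sub_zero, sub_self]

theorem nu_y_mul_x_mul (a : A k) : nu k (y k * (x k * a)) = 0 := by
  obtain ⟨f₀, f₁, g₀, g₁, rfl⟩ := exists_ofCoord a
  rw [x_mul_ofCoord, y_mul_ofCoord, nu_ofCoord]
  simp only [map_zero]
  exact map_zero ofCoord

theorem nu_y_mul_y_mul {a : A k} (ha : nu k a = 0) : nu k (y k * (y k * a)) = 0 := by
  obtain ⟨f₀, f₁, g₀, g₁, rfl⟩ := exists_ofCoord a
  rw [nu_ofCoord, ofCoord_eq_zero_iff] at ha
  obtain ⟨rfl, rfl, -⟩ := ha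
  have h (f : R k) : qt (Polynomial.X * pi f) = 0 := by
    rw [← qt_pi (Polynomial.X * pi f)]; simp [pi_pi]
  rw [y_mul_ofCoord, y_mul_ofCoord, nu_ofCoord]
  simp only [mul_zero, add_zero, h, qt_pi, map_zero]
  exact map_zero ofCoord

theorem nu_nu_right (a : A k) : nu k (a - x k * nu k a) = 0 := by
  rw [map_sub, nu_x_mul, nu_nu, mul_zero, sub_zero, sub_self]

theorem kappa_x_mul (a : A k) : kappa k (x k * a) = 0 := by
  obtain ⟨f₀, f₁, g₀, g₁, rfl⟩ := exists_ofCoord a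
  rw [x_mul_ofCoord, kappa_ofCoord, map_zero]
  exact map_zero ofCoord

theorem kappa_y_mul_x_mul {a : A k} (ha : nu k a = 0) : kappa k (y k * (x k * a)) = a := by
  obtain ⟨f₀, f₁, g₀, g₁, rfl⟩ := exists_ofCoord a
  rw [nu_ofCoord, ofCoord_eq_zero_iff] at ha
  obtain ⟨rfl, rfl, -⟩ := ha
  rw [x_mul_ofCoord, y_mul_ofCoord, kappa_ofCoord]
  simp only [map_zero, mul_zero, zero_add, qt_C_X_mul]

theorem kappa_y_mul {a : A k} (ha : nu k a = 0) : kappa k (y k * a) = 0 := by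
  obtain ⟨f₀, f₁, g₀, g₁, rfl⟩ := exists_ofCoord a
  rw [nu_ofCoord, ofCoord_eq_zero_iff] at ha
  obtain ⟨rfl, rfl, -⟩ := ha
  have h (f : R k) : qt (Polynomial.X * pi f) = 0 := by
    rw [← qt_pi (Polynomial.X * pi f)]; simp [pi_pi]
  rw [y_mul_ofCoord, kappa_ofCoord]
  simp only [mul_zero, add_zero, h, qt_pi]
  exact map_zero ofCoord

theorem exists_qt_pow_eq_zero (f : R k) : ∃ j, ∀ m ≥ j, (qt ^ m) f = 0 := by
  induction f using R_induction with
  | add f g hf hg =>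
    obtain ⟨i, hi⟩ := hf
    obtain ⟨j, hj⟩ := hg
    exact ⟨i + j, fun m hm => by rw [map_add, hi m (by omega), hj m (by omega), add_zero]⟩
  | mon p n =>
    refine ⟨p.natDegree + 1, fun m hm => ?_⟩
    have h (m : ℕ) : (qt ^ m) (Polynomial.C p * Polynomial.X ^ n) =
        Polynomial.C (Polynomial.divX^[m] p) * Polynomial.X ^ n := by
      induction m with
      | zero => rfl
      | succ m ih =>
        rw [pow_succ', Module.End.mul_apply, ih, qt, coeffwise_C_mul_X_pow,
          Function.iterate_succ_apply']
        rfl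
    have hc (m i : ℕ) : (Polynomial.divX^[m] p).coeff i = p.coeff (i + m) := by
      induction m generalizing i with
      | zero => rfl
      | succ m ih =>
        rw [Function.iterate_succ_apply', Polynomial.coeff_divX, ih]
        congr 1
        omega
    have h0 : Polynomial.divX^[m] p = 0 := by
      ext i
      rw [hc, Polynomial.coeff_eq_zero_of_natDegree_lt (by omega), Polynomial.coeff_zero]
    rw [h, h0, Polynomial.C_0, zero_mul]

theorem exists_kappa_pow_eq_zero (a : A k) : ∃ j, ∀ m ≥ j, (kappa k ^ m) a = 0 := by
  obtain ⟨f₀, f₁, g₀, g₁, rfl⟩ := exists_ofCoord a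
  obtain ⟨i, hi⟩ := exists_qt_pow_eq_zero f₀
  obtain ⟨j, hj⟩ := exists_qt_pow_eq_zero f₁
  have h (m : ℕ) : (kappa k ^ (m + 1)) (ofCoord (f₀, f₁, g₀, g₁)) =
      ofCoord ((qt ^ (m + 1)) f₀, (qt ^ (m + 1)) f₁, 0, 0) := by
    induction m with
    | zero => simp only [zero_add, pow_one, kappa_ofCoord]
    | succ m ih =>
      rw [pow_succ', Module.End.mul_apply, ih, kappa_ofCoord, pow_succ' qt (m + 1)]
      rfl
  refine ⟨i + j + 1, fun m hm => ?_⟩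
  obtain ⟨m, rfl⟩ : ∃ n, m = n + 1 := ⟨m - 1, by omega⟩
  rw [h, hi _ (by omega), hj _ (by omega)]
  exact map_zero ofCoord

/-- The generator `wx` for a generator `w`. -/
def Cell.up {n : ℕ} : Cell (n + 1) → Cell (n + 2)
  | .xPow _ => .xPow (n + 1)
  | .yWord _ => .yWord (n + 1)

variable (k) in
/-- The map `a ⊗ w ⊗ xb ↦ ± a ⊗ wx ⊗ b`. -/
noncomputable def htpy (n : ℕ) : P k (n + 2) →ₗ[k] P k (n + 3) :=
  liftP fun w => (-1 : ℤ) ^ (n + 3) • (elL w.up).compl₂ (nu k)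

variable (k) in
/-- The projection that removes the summands `a ⊗ w ⊗ xb`. -/
noncomputable def prP (n : ℕ) : P k (n + 2) →ₗ[k] P k (n + 2) :=
  liftP fun w => (elL w).compl₂ (LinearMap.id - LinearMap.mulLeft k (x k) ∘ₗ nu k)

theorem htpy_el (n : ℕ) (a b : A k) (w : Cell (n + 2)) :
    htpy k n (el a w b) = (-1 : ℤ) ^ (n + 3) • el a w.up (nu k b) := by
  rw [htpy, liftP_el]; rfl

theorem prP_el (n : ℕ) (a b : A k) (w : Cell (n + 2)) :
    prP k n (el a w b) = el a w (b - x k * nu k b) := by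
  rw [prP, liftP_el]; rfl

theorem el_sub_right {n : ℕ} (a b b' : A k) (w : Cell n) :
    el a w (b - b') = el a w b - el a w b' := (elL w a).map_sub b b'

theorem sign_smul_sign_smul {N : Type*} [AddCommGroup N] (n : ℕ) (a : N) :
    (-1 : ℤ) ^ n • (-1 : ℤ) ^ n • a = a := by
  rw [smul_smul, ← mul_pow]; simp

theorem dP_xPow (n : ℕ) (a b : A k) : dP k (n + 2) (el a (.xPow (n + 2)) b) =
    el (a * x k) (.xPow (n + 1)) b + (-1 : ℤ) ^ (n + 3) • el a (.xPow (n + 1)) (x k * b) := by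
  simp only [dP_el, bd, smul_add, smul_comm (ten a b), smul_el, mul_one, one_mul]

theorem dP_yWord (n : ℕ) (a b : A k) : dP k (n + 2) (el a (.yWord (n + 2)) b) =
    el (a * (y k * y k)) (.xPow (n + 1)) b +
      (-1 : ℤ) ^ (n + 3) • el a (.yWord (n + 1)) (x k * b)
      - (el (a * x k) (.yWord (n + 1)) b + el (a * (x k * y k)) (.xPow (n + 1)) b
        + el a (.xPow (n + 1)) (y k * (y k * b)) + el a (.xPow (n + 1)) (y k * (x k * b))) := by
  simp only [dP_el, bd, smul_add, smul_sub, smul_comm (ten a b), smul_el, mul_one, one_mul,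
    mul_assoc]

/-- As a right factor, A is B ⊕ xB, where B is the kernel of `nu`. Subtracting the boundary of
`htpy` replaces a summand in A ⊗ w ⊗ xB by ones with right factor in B, since yxA and y²B lie in B.
-/
theorem prP_sub_dP_htpy (n : ℕ) (p : P k (n + 2)) :
    prP k n (p - dP k (n + 2) (htpy k n p)) = p - dP k (n + 2) (htpy k n p) := by
  induction p using P_induction with
  | zero => simp only [map_zero, sub_zero]
  | add p q hp hq =>
    have : p + q - dP k (n + 2) (htpy k n (p + q)) =
        (p - dP k (n + 2) (htpy k n p)) + (q - dP k (n + 2) (htpy k n q)) := by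
      simp only [map_add]; abel
    rw [this, map_add, hp, hq]
  | el a w b =>
    have h1 : b - x k * nu k b - x k * nu k (b - x k * nu k b) = b - x k * nu k b := by
      rw [nu_nu_right, mul_zero, sub_zero]
    match w with
    | .xPow _ =>
      simp only [htpy_el, Cell.up, map_zsmul, dP_xPow, smul_add, sign_smul_sign_smul]
      have e : ∀ p q r : P k (n + 2), p - (q + r) = p - r - q := by intros; abel
      rw [e, ← el_sub_right]
      simp only [map_sub (prP k n), map_zsmul, prP_el, h1, nu_nu, mul_zero, sub_zero]
    | .yWord _ =>
      simp only [htpy_el, Cell.up, map_zsmul, dP_yWord, smul_add, smul_sub, sign_smul_sign_smul]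
      have e : ∀ p q r s t v w : P k (n + 2),
        p - (q + r - (s + t + v + w)) = (p - r) - q + s + t + v + w := by intros; abel
      rw [e, ← el_sub_right]
      simp only [map_sub (prP k n), map_add, map_zsmul, prP_el, h1, nu_nu, nu_y_mul_x_mul,
        nu_y_mul_y_mul (nu_nu _), mul_zero, sub_zero]

theorem htpy_dP_prP (n : ℕ) (p : P k (n + 3)) :
    htpy k n (dP k (n + 2) (prP k (n + 1) p)) = prP k (n + 1) p := by
  induction p using P_induction with
  | zero => simp only [map_zero]
  | add p q hp hq => simp only [map_add, hp, hq]
  | el a w b =>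
    rw [prP_el]
    obtain ⟨c, hc⟩ : ∃ c, c = b - x k * nu k b := ⟨_, rfl⟩
    have hn : nu k c = 0 := by rw [hc, nu_nu_right]
    rw [← hc]
    match w with
    | .xPow _ =>
      simp only [dP_xPow, map_add, map_zsmul, htpy_el, hn, el_zero_right, smul_zero, zero_add,
        sign_smul_sign_smul, nu_x_mul, mul_zero, sub_zero, Cell.up]
    | .yWord _ =>
      simp only [dP_yWord, map_add, map_sub, map_zsmul, htpy_el, hn, el_zero_right, smul_zero,
        zero_add, sign_smul_sign_smul, nu_x_mul, mul_zero, sub_zero, Cell.up, nu_y_mul_x_mul,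
        nu_y_mul_y_mul hn]

theorem dP_dP (n : ℕ) (p : P k (n + 2)) : dP k n (dP k (n + 1) p) = 0 :=
  LinearMap.congr_fun (dP_comp_dP k n) p

/-- Modulo a boundary, a cycle has right factors in the kernel of `nu`; there `htpy` is a left
inverse of the differential, so the cycle is zero. -/
theorem exact_dP_add_three (n : ℕ) (p : P k (n + 3)) (hp : dP k (n + 2) p = 0) :
    ∃ q, dP k (n + 3) q = p := by
  refine ⟨htpy k (n + 1) p, ?_⟩
  have h1 := prP_sub_dP_htpy (n + 1) p
  have h2 := htpy_dP_prP n (p - dP k (n + 3) (htpy k (n + 1) p))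
  rw [h1, map_sub, hp, dP_dP, sub_zero, map_zero] at h2
  exact (sub_eq_zero.mp h2.symm).symm

variable (k) in
noncomputable def htpyOne : P k 1 →ₗ[k] P k 2 :=
  liftP fun
    | .xPow _ => (elL (.xPow 1)).compl₂ (nu k)
    | .yWord _ => (elL (.yWord 1)).compl₂ (kappa k)

variable (k) in
noncomputable def defect : P k 2 →ₗ[k] P k 2 :=
  liftP fun
    | .xPow _ => 0
    | .yWord _ => (elL (.yWord 1)).compl₁₂ (LinearMap.mulRight k (x k * y k)) (kappa k)

theorem htpyOne_xPow (a b : A k) : htpyOne k (el a (.xPow 0) b) = el a (.xPow 1) (nu k b) := by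
  rw [htpyOne, liftP_el]; rfl

theorem htpyOne_yWord (a b : A k) :
    htpyOne k (el a (.yWord 0) b) = el a (.yWord 1) (kappa k b) := by
  rw [htpyOne, liftP_el]; rfl

theorem defect_xPow (a b : A k) : defect k (el a (.xPow 1) b) = 0 := by
  rw [defect, liftP_el]; rfl

theorem defect_yWord (a b : A k) :
    defect k (el a (.yWord 1) b) = el (a * (x k * y k)) (.yWord 1) (kappa k b) := by
  rw [defect, liftP_el]; rfl

theorem dP_one_xPow (a b : A k) : dP k 1 (el a (.xPow 1) b) =
    el (a * x k) (.xPow 0) b + el a (.xPow 0) (x k * b) := by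
  simp only [dP_el, bd, smul_add, smul_el, mul_one, one_mul]

theorem dP_one_yWord (a b : A k) : dP k 1 (el a (.yWord 1) b) =
    el (a * (y k * y k)) (.xPow 0) b + el (a * y k) (.yWord 0) (x k * b)
      + el a (.yWord 0) (y k * (x k * b))
      - (el (a * (x k * y k)) (.yWord 0) b + el (a * x k) (.yWord 0) (y k * b)
        + el a (.xPow 0) (y k * (y k * b)))
      - (el (a * (x k * y k)) (.xPow 0) b + el (a * x k) (.yWord 0) (x k * b)
        + el a (.xPow 0) (y k * (x k * b))) := by
  simp only [dP_el, bd, smul_add, smul_sub, smul_el, mul_one, one_mul, mul_assoc]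

/-- In d₁ of y²x the summand with right factor yx·b is recovered by `kappa`. The summand with left
factor xy and right factor b also contributes, and gives the error term. -/
theorem htpyOne_dP_prP (p : P k 2) :
    htpyOne k (dP k 1 (prP k 0 p)) = prP k 0 p - defect k (prP k 0 p) := by
  induction p using P_induction with
  | zero => simp only [map_zero, sub_zero]
  | add p q hp hq => simp only [map_add, hp, hq]; abel
  | el a w b =>
    rw [prP_el]
    obtain ⟨c, hc⟩ : ∃ c, c = b - x k * nu k b := ⟨_, rfl⟩
    have hn : nu k c = 0 := by rw [hc, nu_nu_right]
    rw [← hc]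
    match w with
    | .xPow _ =>
      simp only [dP_one_xPow, map_add, htpyOne_xPow, hn, el_zero_right, zero_add,
        nu_x_mul, mul_zero, sub_zero, defect_xPow]
    | .yWord _ =>
      simp only [dP_one_yWord, map_add, map_sub, htpyOne_xPow, htpyOne_yWord, hn, el_zero_right,
        zero_add, add_zero, sub_zero, nu_y_mul_x_mul, nu_y_mul_y_mul hn, defect_yWord,
        kappa_x_mul, kappa_y_mul_x_mul hn, kappa_y_mul hn]

/-- Each application divides the right factor by q, which lowers its degree in q; the left factor is
irrelevant. -/
theorem exists_defect_pow_eq_zero (p : P k 2) : ∃ j, ∀ m ≥ j, (defect k ^ m) p = 0 := by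
  induction p using P_induction with
  | zero => exact ⟨0, fun m _ => map_zero _⟩
  | add f g hf hg =>
    obtain ⟨i, hi⟩ := hf
    obtain ⟨j, hj⟩ := hg
    exact ⟨i + j, fun m hm => by rw [map_add, hi m (by omega), hj m (by omega), add_zero]⟩
  | el a w b =>
    match w with
    | .xPow _ =>
      refine ⟨1, fun m hm => ?_⟩
      obtain ⟨m, rfl⟩ : ∃ n, m = n + 1 := ⟨m - 1, by omega⟩
      rw [pow_succ, Module.End.mul_apply, defect_xPow, map_zero]
    | .yWord _ =>
      obtain ⟨j, hj⟩ := exists_kappa_pow_eq_zero b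
      refine ⟨j, fun m hm => ?_⟩
      have h (m : ℕ) : ∃ a', (defect k ^ m) (el a (.yWord 1) b) =
          el a' (.yWord 1) ((kappa k ^ m) b) := by
        induction m with
        | zero => exact ⟨a, rfl⟩
        | succ m ih =>
          obtain ⟨a', ha'⟩ := ih
          exact ⟨a' * (x k * y k), by
            rw [pow_succ', Module.End.mul_apply, ha', defect_yWord, pow_succ',
              Module.End.mul_apply]⟩
      obtain ⟨a', ha'⟩ := h m
      rw [ha', hj m hm, el_zero_right]

theorem exact_dP_two (p : P k 2) (hp : dP k 1 p = 0) : ∃ q, dP k 2 q = p := by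
  refine ⟨htpy k 0 p, ?_⟩
  obtain ⟨r, hr⟩ : ∃ r, r = p - dP k 2 (htpy k 0 p) := ⟨_, rfl⟩
  have h1 : prP k 0 r = r := by rw [hr]; exact prP_sub_dP_htpy 0 p
  have h2 := htpyOne_dP_prP r
  have h3 : dP k 1 r = 0 := by rw [hr, map_sub, hp, dP_dP, sub_zero]
  rw [h1, h3, map_zero, eq_comm, sub_eq_zero] at h2
  obtain ⟨j, hj⟩ := exists_defect_pow_eq_zero r
  -- The normalised cycle is fixed by a locally nilpotent map, hence is zero.
  have h4 (m : ℕ) : (defect k ^ m) r = r := by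
    induction m with
    | zero => rfl
    | succ m ih => rw [pow_succ, Module.End.mul_apply, ← h2, ih]
  rw [h4 j |>.symm.trans (hj j le_rfl), eq_comm, sub_eq_zero] at hr
  exact hr.symm

section DegreeOne

variable (k)

/-- The bimodule of noncommutative differentials, by generators and relations. -/
abbrev Omega : Type u := P k 1 ⧸ LinearMap.range (dP k 1)

variable {k}

/-- The extension of left multiplication by `a` to `A ⊕ Ω`, by a given differential of `a`. -/
noncomputable def extMul (a : A k) (w : Cell 1) : A k × Omega k →ₗ[k] A k × Omega k :=
  (LinearMap.mulLeft k a ∘ₗ LinearMap.fst k _ _).prod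
    (Algebra.lsmul k k (Omega k) (ten a 1) ∘ₗ LinearMap.snd k _ _ +
      ((LinearMap.range (dP k 1)).mkQ.restrictScalars k ∘ₗ elL w 1) ∘ₗ LinearMap.fst k _ _)

theorem extMul_apply (a : A k) (w : Cell 1) (b : A k) (ξ : Omega k) :
    extMul a w (b, ξ) = (a * b, ten a 1 • ξ + Submodule.Quotient.mk (el 1 w b)) := rfl

theorem mk_dP_one (p : P k 2) : (Submodule.Quotient.mk (dP k 1 p) : Omega k) = 0 :=
  (Submodule.Quotient.mk_eq_zero _).mpr ⟨p, rfl⟩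

/-- A derivation into Ω is encoded as an action on A ⊕ Ω. The relations of A hold because their
Ω-components are the images under `dP k 1` of the generators of degree 2. -/
noncomputable def extAct : A k →ₐ[k] Module.End k (A k × Omega k) :=
  RingQuot.liftAlgHom k (s := Rel k)
    ⟨FreeAlgebra.lift k ![extMul (x k) (.xPow 0), extMul (y k) (.yWord 0)], by
    rintro _ _ (_ | _)
    · refine LinearMap.ext fun ⟨b, ξ⟩ => ?_
      have h := mk_dP_one (el 1 (.xPow 1) b)
      rw [dP_one_xPow, Submodule.Quotient.mk_add] at h
      simp only [map_mul, FreeAlgebra.lift_ι_apply, Matrix.cons_val_zero, Module.End.mul_apply,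
        extMul_apply, x_mul_x', smul_add, smul_smul, ten_mul_ten, x_mul_x, ten_zero_left,
        zero_smul, zero_add, map_zero, LinearMap.zero_apply, ← Submodule.Quotient.mk_smul, smul_el,
        mul_one]
      rw [one_mul] at h
      rw [h]
      rfl
    · refine LinearMap.ext fun ⟨b, ξ⟩ => ?_
      have h := mk_dP_one (el 1 (.yWord 1) b)
      rw [dP_one_yWord] at h
      simp only [map_mul, map_add, FreeAlgebra.lift_ι_apply, Matrix.cons_val_zero,
        Matrix.cons_val_one, Module.End.mul_apply, LinearMap.add_apply,
        extMul_apply, smul_add, smul_smul, ten_mul_ten, ← Submodule.Quotient.mk_smul, smul_el,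
        one_mul, mul_one, Prod.mk_add_mk, mul_assoc, y_mul_y_mul_x_mul, y_mul_y_mul_x,
        ten_add_left, add_smul, Submodule.Quotient.mk_add, Submodule.Quotient.mk_sub,
        Prod.mk.injEq, true_and] at h ⊢
      rw [← sub_eq_zero, ← h]
      abel⟩

theorem extAct_x : extAct (x k) = extMul (x k) (.xPow 0) := by
  change RingQuot.liftAlgHom k _ (RingQuot.mkAlgHom k _ _) = _
  rw [RingQuot.liftAlgHom_mkAlgHom_apply]
  simp

theorem extAct_y : extAct (y k) = extMul (y k) (.yWord 0) := by
  change RingQuot.liftAlgHom k _ (RingQuot.mkAlgHom k _ _) = _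
  rw [RingQuot.liftAlgHom_mkAlgHom_apply]
  simp

/-- The universal derivation. -/
noncomputable def univDer : A k →ₗ[k] Omega k :=
  LinearMap.snd k _ _ ∘ₗ LinearMap.applyₗ (1, 0) ∘ₗ extAct.toLinearMap

theorem extAct_one_zero (a : A k) : extAct a (1, 0) = (a, univDer a) := by
  refine Prod.ext ?_ rfl
  induction a using A_induction with
  | one => simp
  | add a b ha hb => simp [ha, hb]
  | smul r a ha => simp [ha]
  | x_mul a ha =>
    rw [map_mul, Module.End.mul_apply, extAct_x]
    change x k * (extAct a (1, 0)).1 = _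
    rw [ha]
  | y_mul a ha =>
    rw [map_mul, Module.End.mul_apply, extAct_y]
    change y k * (extAct a (1, 0)).1 = _
    rw [ha]

theorem univDer_x_mul (a : A k) :
    univDer (x k * a) = ten (x k) 1 • univDer a + Submodule.Quotient.mk (el 1 (.xPow 0) a) := by
  change (extAct (x k * a) (1, 0)).2 = _
  rw [map_mul, Module.End.mul_apply, extAct_one_zero, extAct_x, extMul_apply]

theorem univDer_y_mul (a : A k) :
    univDer (y k * a) = ten (y k) 1 • univDer a + Submodule.Quotient.mk (el 1 (.yWord 0) a) := by
  change (extAct (y k * a) (1, 0)).2 = _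
  rw [map_mul, Module.End.mul_apply, extAct_one_zero, extAct_y, extMul_apply]

/-- The sign compensates for d₀ having the term with x or y on the right factor negative; by
`toOmega_dP`, the composite with d₀ is the quotient map, which gives exactness at degree 1. -/
noncomputable def toOmega : P k 0 →ₗ[k] Omega k :=
  liftP fun _ => -((LinearMap.mk₂ k (fun a ξ => ten a 1 • ξ)
    (fun a a' ξ => by rw [ten_add_left, add_smul])
    (fun r a ξ => by rw [ten_smul_left, smul_assoc])
    (fun a ξ ξ' => smul_add _ _ _)
    (fun r a ξ => smul_comm _ _ _)).compl₂ univDer)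

theorem toOmega_el (a b : A k) : toOmega (el a .one b) = -(ten a 1 • univDer b) := by
  rw [toOmega, liftP_el]; rfl

theorem dP_zero_xPow (a b : A k) : dP k 0 (el a (.xPow 0) b) =
    el (a * x k) .one b - el a .one (x k * b) := by
  simp only [dP_el, bd, smul_sub, smul_el, mul_one, one_mul]

theorem dP_zero_yWord (a b : A k) : dP k 0 (el a (.yWord 0) b) =
    el (a * y k) .one b - el a .one (y k * b) := by
  simp only [dP_el, bd, smul_sub, smul_el, mul_one, one_mul]

theorem toOmega_dP (p : P k 1) : toOmega (dP k 0 p) = Submodule.Quotient.mk p := by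
  induction p using P_induction with
  | zero => simp only [map_zero, Submodule.Quotient.mk_zero]
  | add p q hp hq => simp only [map_add, hp, hq, Submodule.Quotient.mk_add]
  | el a w b =>
    match w with
    | .xPow _ =>
      rw [dP_zero_xPow, map_sub, toOmega_el, toOmega_el, univDer_x_mul, smul_add, smul_smul,
        ten_mul_ten, ← Submodule.Quotient.mk_smul, smul_el, one_mul, mul_one, mul_one]
      abel
    | .yWord _ =>
      rw [dP_zero_yWord, map_sub, toOmega_el, toOmega_el, univDer_y_mul, smul_add, smul_smul,
        ten_mul_ten, ← Submodule.Quotient.mk_smul, smul_el, one_mul, mul_one, mul_one]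
      abel

theorem exact_dP_one (p : P k 1) (hp : dP k 0 p = 0) : ∃ q, dP k 1 q = p := by
  have h := toOmega_dP p
  rw [hp, map_zero] at h
  exact (Submodule.Quotient.mk_eq_zero _).mp h.symm

end DegreeOne

variable (k) in
/-- The multiplication `A ⊗ A → A`. -/
noncomputable def mulP : P k 0 →ₗ[Ae k] A k := Finsupp.linearCombination (Ae k) fun _ => (1 : A k)

theorem mulP_el (a b : A k) : mulP k (el a .one b) = a * b := by
  simp [mulP, el, ten_smul]

theorem el_sub_el_mem (a b : A k) :
    el a .one b - el (a * b) .one 1 ∈ LinearMap.range (dP k 0) := by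
  induction b using A_induction generalizing a with
  | one => simp
  | add b b' h h' =>
    have := add_mem (h a) (h' a)
    rwa [mul_add, el_add_left, el_add_right, add_sub_add_comm]
  | smul r b h =>
    have := Submodule.smul_mem _ (algebraMap k (Ae k) r) (h a)
    rw [algebraMap_smul, smul_sub] at this
    rw [mul_smul_comm, ← elL_apply, map_smul, ← elL_apply (a := r • (a * b)), map_smul]
    exact this
  | x_mul b h =>
    have := sub_mem (h (a * x k)) (⟨_, dP_zero_xPow a b⟩ : _ ∈ LinearMap.range (dP k 0))
    rw [mul_assoc] at this
    convert this using 1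
    abel
  | y_mul b h =>
    have := sub_mem (h (a * y k)) (⟨_, dP_zero_yWord a b⟩ : _ ∈ LinearMap.range (dP k 0))
    rw [mul_assoc] at this
    convert this using 1
    abel

theorem exact_dP_zero (p : P k 0) (hp : mulP k p = 0) : ∃ q, dP k 0 q = p := by
  have h : p - el (mulP k p) .one 1 ∈ LinearMap.range (dP k 0) := by
    clear hp
    induction p using P_induction with
    | zero => simp [el_zero_left]
    | add p q hp hq =>
      have e : p + q - el (mulP k (p + q)) .one 1 =
          (p - el (mulP k p) .one 1) + (q - el (mulP k q) .one 1) := by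
        rw [map_add, el_add_left]; abel
      rw [e]
      exact add_mem hp hq
    | el a w b => match w with
      | .one => rw [mulP_el]; exact el_sub_el_mem a b
  rw [hp, el_zero_left, sub_zero] at h
  exact h

end Exactness

end SuperJordanPlane

namespace SuperJordanPlane

/-! ### From cocycles to classes in Ext. -/

section Ext

open Polynomial

variable (k : Type u) [Field k]

theorem augmentation_f_zero : (augmentation k).f 0 = cochain k (fun _ => 1) :=
  ChainComplex.toSingle₀Equiv_symm_apply_f_zero _ _

theorem exactAt_succ (n : ℕ) : (complexP k).ExactAt (n + 1) := by
  rw [HomologicalComplex.exactAt_iff' _ (n + 2) (n + 1) n (by simp) (by simp),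
    ShortComplex.moduleCat_exact_iff]
  intro p hp
  change ((complexP k).d (n + 1) n).hom p = 0 at hp
  change ∃ q, ((complexP k).d (n + 2) (n + 1)).hom q = p
  rw [complexP_d] at hp ⊢
  match n, p, hp with
  | 0, p, hp => exact exact_dP_one p hp
  | 1, p, hp => exact exact_dP_two p hp
  | n + 2, p, hp => exact exact_dP_add_three n p hp

theorem quasiIso_augmentation : QuasiIso (augmentation k) where
  quasiIsoAt n := by
    cases n with
    | zero =>
      rw [ChainComplex.quasiIsoAt₀_iff, ShortComplex.quasiIso_iff_of_zeros' _ rfl rfl rfl]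
      constructor
      · rw [ShortComplex.moduleCat_exact_iff]
        intro p hp
        change ((augmentation k).f 0).hom p = 0 at hp
        change ∃ q, ((complexP k).d 1 0).hom q = p
        rw [augmentation_f_zero] at hp
        rw [complexP_d]
        exact exact_dP_zero p hp
      · change Epi ((augmentation k).f 0)
        rw [augmentation_f_zero]
        refine (ModuleCat.epi_iff_surjective (cochain k fun _ => 1)).mpr fun a => ?_
        exact ⟨el a .one 1, (mulP_el a 1).trans (mul_one a)⟩
    | succ n =>
      rw [quasiIsoAt_iff_exactAt' (hL := ChainComplex.exactAt_succ_single_obj ..)]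
      exact exactAt_succ k n

variable {k}

theorem cochain_injective {n : ℕ} {f g : Cell n → A k} (h : cochain k f = cochain k g) :
    f = g := by
  ext w
  have := congrArg (fun φ => φ.hom (Finsupp.single w (1 : Ae k))) h
  change Finsupp.linearCombination (Ae k) f _ = Finsupp.linearCombination (Ae k) g _ at this
  simpa using this

theorem exists_cochain {n : ℕ} (φ : (complexP k).X n ⟶ bimod k) : ∃ f, φ = cochain k f := by
  let φ' : P k n →ₗ[Ae k] A k := φ.hom
  refine ⟨fun w => φ' (Finsupp.single w 1), ModuleCat.hom_ext ?_⟩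
  change φ' = Finsupp.linearCombination (Ae k) _
  refine Finsupp.lhom_ext' fun w => LinearMap.ext_ring ?_
  simp

theorem d_comp_cochain {n : ℕ} (f : Cell n → A k) :
    (complexP k).d (n + 1) n ≫ cochain k f =
      cochain k fun w => Finsupp.linearCombination (Ae k) f (bd k n w) := by
  rw [complexP_d]
  refine ModuleCat.hom_ext ?_
  change Finsupp.linearCombination (Ae k) f ∘ₗ dP k n = Finsupp.linearCombination (Ae k) _
  refine Finsupp.lhom_ext' fun w => LinearMap.ext_ring ?_
  simp [dP]

theorem linearCombination_el {n : ℕ} (f : Cell n → A k) (a b : A k) (w : Cell n) :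
    Finsupp.linearCombination (Ae k) f (el a w b) = a * (f w * b) := by
  simp [el, ten_smul]

theorem cochain_pair_add {n : ℕ} (p q : A k × A k) :
    cochain k (pair k (n := n) (p + q)) = cochain k (pair k p) + cochain k (pair k q) := by
  refine ModuleCat.hom_ext (Finsupp.lhom_ext' fun w => LinearMap.ext_ring ?_)
  change Finsupp.linearCombination (Ae k) (pair k (p + q)) (Finsupp.single w 1) =
    Finsupp.linearCombination (Ae k) (pair k p) (Finsupp.single w 1) +
    Finsupp.linearCombination (Ae k) (pair k q) (Finsupp.single w 1)
  cases w <;> simp [pair]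

theorem cochain_pair_smul {n : ℕ} (r : k) (p : A k × A k) :
    cochain k (pair k (n := n) (r • p)) = cochain k (pair k p) ≫ (r • 𝟙 (bimod k)) := by
  refine ModuleCat.hom_ext (Finsupp.lhom_ext' fun w => LinearMap.ext_ring ?_)
  change Finsupp.linearCombination (Ae k) (pair k (r • p)) (Finsupp.single w 1) =
    algebraMap k (Ae k) r • Finsupp.linearCombination (Ae k) (pair k p) (Finsupp.single w 1)
  have h (a : A k) : algebraMap k (Ae k) r • a = r • a := by
    change ten (algebraMap k (A k) r) 1 • a = _
    rw [ten_smul, mul_one, Algebra.smul_def]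
  rw [h]
  cases w <;> simp [pair]

theorem exists_pair {n : ℕ} (f : Cell (n + 1) → A k) : ∃ p, f = pair k p :=
  ⟨(f (.xPow n), f (.yWord n)), funext fun w => by cases w <;> rfl⟩

theorem pair_injective {n : ℕ} {p q : A k × A k} (h : pair k (n := n) p = pair k q) : p = q :=
  Prod.ext (congrFun h (.xPow n)) (congrFun h (.yWord n))

variable (k) in
/-- The Hochschild differential from degree `n + 1` to degree `n + 2`. -/
noncomputable def delta : ℕ → A k × A k →ₗ[k] A k × A k
  | 0 => d1 k
  -- Here the source degree is n + 2, which has the parity of n.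
  | n + 1 => if Even n then dEven k else dOdd k

variable (k) in
/-- The coboundaries of degree `n + 1`. -/
noncomputable def cob : ℕ → Submodule k (A k × A k)
  | 0 => LinearMap.range (d0 k)
  | n + 1 => LinearMap.range (delta k n)

theorem d_comp_cochain_pair (n : ℕ) (p : A k × A k) :
    (complexP k).d (n + 2) (n + 1) ≫ cochain k (pair k p) = cochain k (pair k (delta k n p)) := by
  obtain ⟨a, b⟩ := p
  rw [d_comp_cochain]
  congr 1
  funext w
  match n, w with
  | 0, .xPow _ =>
    simp only [bd, map_add, linearCombination_el, pair, delta, d1_apply, Lp_apply, mul_one,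
      one_mul]
  | 0, .yWord _ =>
    simp only [bd, map_add, map_sub, linearCombination_el, pair, delta, d1_apply, mul_one,
      one_mul, T_apply, Lm_apply, E_apply, mul_assoc,
      x_mul_x', zero_sub]
    abel
  | n + 1, .xPow _ =>
    rcases Nat.even_or_odd n with h | h
    · simp [bd, linearCombination_el, pair, delta, dEven_apply, h, pow_add, h.neg_one_pow,
        Lm_apply, sub_eq_add_neg]
    · simp [bd, linearCombination_el, pair, delta, dOdd_apply, Nat.not_even_iff_odd.mpr h,
        pow_add, h.neg_one_pow, Lp_apply]
  | n + 1, .yWord _ =>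
    rcases Nat.even_or_odd n with h | h
    · simp only [bd, map_add, map_sub, map_zsmul, linearCombination_el, pair, delta, dEven_apply,
        h, if_true, pow_add, h.neg_one_pow, mul_one, one_mul, T_apply, Lp_apply]
      norm_num
      abel
    · simp only [bd, map_add, map_sub, map_zsmul, linearCombination_el, pair, delta, dOdd_apply,
        Nat.not_even_iff_odd.mpr h, if_false, pow_add, h.neg_one_pow, mul_one, one_mul, T_apply,
        Lm_apply]
      norm_num
      abel

theorem d_comp_cochain_zero (f : Cell 0 → A k) :
    (complexP k).d 1 0 ≫ cochain k f = cochain k (pair k (d0 k (f .one))) := by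
  rw [d_comp_cochain]
  congr 1
  funext w
  cases w <;> simp [bd, linearCombination_el, pair, d0_apply, Lm_apply, Dy_apply]

theorem exists_d_comp_eq_iff (n : ℕ) (p : A k × A k) :
    (∃ φ : (complexP k).X n ⟶ bimod k, (complexP k).d (n + 1) n ≫ φ = cochain k (pair k p)) ↔
      p ∈ cob k n := by
  constructor
  · rintro ⟨φ, hφ⟩
    obtain ⟨f, rfl⟩ := exists_cochain φ
    cases n with
    | zero =>
      rw [d_comp_cochain_zero] at hφ
      exact ⟨_, pair_injective (cochain_injective hφ)⟩
    | succ n =>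
      obtain ⟨q, rfl⟩ := exists_pair f
      rw [d_comp_cochain_pair] at hφ
      exact ⟨q, pair_injective (cochain_injective hφ)⟩
  · intro hp
    cases n with
    | zero =>
      obtain ⟨a, rfl⟩ := hp
      exact ⟨cochain k fun _ => a, d_comp_cochain_zero _⟩
    | succ n =>
      obtain ⟨q, rfl⟩ := hp
      exact ⟨cochain k (pair k q), d_comp_cochain_pair _ _⟩

theorem d_comp_cochain_pair_eq_zero_iff (n : ℕ) (p : A k × A k) :
    (complexP k).d (n + 2) (n + 1) ≫ cochain k (pair k p) = 0 ↔ delta k n p = 0 := by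
  have h0 : cochain k (pair k (n := n + 1) 0) = 0 := by
    have := cochain_pair_add (k := k) (n := n + 1) 0 0
    simpa using this
  rw [d_comp_cochain_pair, ← h0]
  exact ⟨fun h => pair_injective (cochain_injective h), fun h => by rw [h]⟩

theorem extMk_congr {C : Type*} [Category C] [Abelian C] [HasExt C] {X Y : C}
    (R : ProjectiveResolution X) {n : ℕ} {f g : R.complex.X n ⟶ Y} (hfg : f = g) (m : ℕ)
    (hm : n + 1 = m) (hf : R.complex.d m n ≫ f = 0) (hg : R.complex.d m n ≫ g = 0) :
    R.extMk f m hm hf = R.extMk g m hm hg := by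
  subst hfg
  rfl

/-- The cohomology classes of a linear family of cocycles. -/
noncomputable def classMap (h : QuasiIso (augmentation k)) (n : ℕ) {V : Type*} [AddCommGroup V]
    [Module k V] (G : V →ₗ[k] A k × A k) (hG : ∀ v, delta k n (G v) = 0) :
    V →ₗ[k] HH k (n + 1) where
  toFun v := (resolution k h).extMk (cochain k (pair k (G v))) (n + 2) rfl
    ((d_comp_cochain_pair_eq_zero_iff n _).mpr (hG v))
  map_add' v v' := by
    have e : cochain k (pair k (n := n) (G (v + v'))) =
        cochain k (pair k (G v)) + cochain k (pair k (G v')) := by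
      rw [map_add, cochain_pair_add]
    exact (extMk_congr (resolution k h) e _ _ _ _).trans
      (ProjectiveResolution.add_extMk (resolution k h) _ _ (n + 2) rfl _ _).symm
  map_smul' r v := by
    have e : cochain k (pair k (n := n) (G (r • v))) =
        cochain k (pair k (G v)) ≫ (r • 𝟙 (bimod k)) := by
      rw [map_smul, cochain_pair_smul]
    rw [RingHom.id_apply, Ext.smul_eq_comp_mk₀]
    exact (extMk_congr (resolution k h) e _ _ _ _).trans
      (ProjectiveResolution.extMk_comp_mk₀ (resolution k h) _ (n + 2) rfl _ _).symm

/-- Reduces the basis claims to linear algebra on pairs: a linear space of cocycles meeting the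
coboundaries trivially, and spanning the cocycles together with them, maps isomorphically onto Ext.
-/
theorem classesFormBasis_of_linearMap (h : QuasiIso (augmentation k)) (n : ℕ) {ι : Type}
    {f : ι → A k × A k} {V : Type*} [AddCommGroup V] [Module k V] (b : Module.Basis ι k V)
    (G : V →ₗ[k] A k × A k) (hGf : ∀ i, G (b i) = f i) (hG : ∀ v, delta k n (G v) = 0)
    (inj : ∀ v, G v ∈ cob k n → v = 0)
    (surj : ∀ p, delta k n p = 0 → ∃ v, p - G v ∈ cob k n) :
    ClassesFormBasis k h n f := by
  have hf (i : ι) : delta k n (f i) = 0 := by rw [← hGf, hG]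
  refine ⟨fun i => (d_comp_cochain_pair_eq_zero_iff n _).mpr (hf i), ?_⟩
  have hinj : Function.Injective (classMap h n G hG) := by
    rw [injective_iff_map_eq_zero]
    intro v hv
    refine inj v ((exists_d_comp_eq_iff n _).mp ?_)
    exact ((resolution k h).extMk_eq_zero_iff (cochain k (pair k (G v))) (n + 2) rfl
      ((d_comp_cochain_pair_eq_zero_iff n _).mpr (hG v)) n rfl).mp hv
  have hsurj : Function.Surjective (classMap h n G hG) := by
    intro α
    obtain ⟨φ, hφ, rfl⟩ := (resolution k h).extMk_surjective α (n + 2) rfl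
    obtain ⟨f', rfl⟩ := exists_cochain φ
    obtain ⟨p, rfl⟩ := exists_pair f'
    have hp := (d_comp_cochain_pair_eq_zero_iff n p).mp hφ
    obtain ⟨v, hv⟩ := surj p hp
    refine ⟨v, ?_⟩
    obtain ⟨ψ, hψ⟩ := (exists_d_comp_eq_iff n _).mpr hv
    have e : cochain k (pair k (n := n) (p - G v)) =
        cochain k (pair k p) - cochain k (pair k (G v)) :=
      eq_sub_of_add_eq ((cochain_pair_add _ _).symm.trans (by rw [sub_add_cancel]))
    refine (sub_eq_zero.mp ?_).symm
    refine (ProjectiveResolution.sub_extMk (resolution k h) _ _ (n + 2) rfl hφ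
      ((d_comp_cochain_pair_eq_zero_iff n _).mpr (hG v))).trans ?_
    exact ((resolution k h).extMk_eq_zero_iff _ (n + 2) rfl _ n rfl).mpr ⟨ψ, hψ.trans e⟩
  refine ⟨b.map (LinearEquiv.ofBijective (classMap h n G hG) ⟨hinj, hsurj⟩), fun i => ?_⟩
  rw [Module.Basis.map_apply]
  exact extMk_congr (resolution k h) (congrArg (fun p => cochain k (pair k p)) (hGf i)) _ _
    ((d_comp_cochain_pair_eq_zero_iff n _).mpr (hG _))
    ((d_comp_cochain_pair_eq_zero_iff n _).mpr (hf i))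

theorem z_succ (n : ℕ) [CharZero k] : z k (n + 1) =
    (y k * y k) ^ (n + 1) + ((n + 1 : ℕ) : k) • (y k * x k * z k n) := by
  rw [z, Finset.sum_range_succ, z, Finset.mul_sum, Finset.smul_sum, add_comm]
  congr 1
  · rw [div_self (Nat.cast_ne_zero.mpr (Nat.factorial_ne_zero _)), Nat.sub_self, pow_zero,
      one_smul, one_mul, pow_mul, pow_two]
  · refine Finset.sum_congr rfl fun i hi => ?_
    rw [mul_smul_comm, smul_smul, ← mul_assoc, ← pow_succ', Nat.factorial_succ]
    rw [Finset.mem_range] at hi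
    have e : n - i + 1 = n + 1 - i := by omega
    rw [e]
    congr 1
    push_cast
    ring

/-- The factorial sum satisfies the recursion that defines `zeta`. -/
theorem z_eq [CharZero k] (n : ℕ) : z k n = (y k * y k + y k * x k) ^ n := by
  rw [← nf_zeta]
  induction n with
  | zero => simp [z, zeta, nf_one]
  | succ n ih =>
    have h1 := nf_mon (1 : k[X]) (n + 1)
    rw [C_1, one_mul, map_one, one_mul] at h1
    rw [z_succ, ih, zeta, map_add, h1, ← nsmul_eq_mul, map_nsmul, nf_C_X_mul, Nat.cast_smul_eq_nsmul]

theorem yy_pow (n : ℕ) : (y k * y k) ^ n = y k ^ (2 * n) := by rw [pow_mul, pow_two]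

theorem y_mul_yy_pow (n : ℕ) : y k * (y k * y k) ^ n = y k ^ (2 * n + 1) := by
  rw [yy_pow, ← pow_succ']

theorem euler_monomial (n : ℕ) : monomial n (1 : k) + ((2 : ℕ) : k[X]) *
    (X * derivative (monomial n 1)) = ((2 * n + 1 : ℕ) : k) • monomial n 1 := by
  ext i
  rw [coeff_euler, coeff_smul, smul_eq_mul, coeff_monomial]
  split_ifs with hi
  · rw [hi]
  · rw [mul_zero, mul_zero]

theorem repOne_monomial (n : ℕ) : repOne k (0, monomial n 1) = s k n := by
  rw [repOne_apply, euler_monomial, map_smul, aeval_monomial, map_one, one_mul, zero_smul,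
    zero_add, y_mul_yy_pow, yy_pow, mul_smul_comm, s]

theorem basisOne [CharZero k] (h : QuasiIso (augmentation k)) :
    ClassesFormBasis k h 0 (Sum.elim (fun _ : Unit => c k) (s k)) := by
  refine classesFormBasis_of_linearMap h 0
    ((Module.Basis.singleton Unit k).prod (basisMonomials k)) (repOne k) ?_ d1_repOne ?_ ?_
  · rintro (i | n)
    · simp [repOne_apply, c]
    · simpa using repOne_monomial n
  · rintro v ⟨a, ha⟩
    exact eq_zero_of_repOne_eq_d0 ha.symm
  · intro p hp
    obtain ⟨v, a, hv⟩ := exists_repOne_add_d0 hp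
    exact ⟨v, a, by rw [hv, add_sub_cancel_left]⟩

theorem repEven_basis [CharZero k] (i : ℕ ⊕ ℕ) :
    repEven k (((basisMonomials k).prod (basisMonomials k)) i) = Sum.elim (t k) (u k) i := by
  rcases i with n | n
  · simp [repEven_apply, t, yy_pow]
  · simp [repEven_apply, u, z_eq, y_mul_yy_pow]

theorem repOdd_basis [CharZero k] (i : ℕ ⊕ ℕ) :
    repOdd k (((basisMonomials k).prod (basisMonomials k)) i) = Sum.elim (v k) (w k) i := by
  rcases i with n | n
  · simp [repOdd_apply, v, z_eq]
  · simp [repOdd_apply, w, yy_pow, pow_succ']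

theorem basisEven [CharZero k] (h : QuasiIso (augmentation k)) (n : ℕ) (hn : Even n) :
    ClassesFormBasis k h (n + 1) (Sum.elim (t k) (u k)) := by
  have hd : delta k (n + 1) = dEven k := by rw [delta, if_pos hn]
  refine classesFormBasis_of_linearMap h _ _ _ repEven_basis
    (fun v => by rw [hd, dEven_repEven]) ?_ ?_
  -- In degree 2 the incoming differential is `d1`; in higher even degrees it is `dOdd`.
  · cases n with
    | zero => exact fun v ⟨p, hp⟩ => eq_zero_of_repEven_eq_d1 hp.symm
    | succ n =>
      have hd' : delta k (n + 1) = dOdd k := by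
        rw [delta, if_neg (by rwa [Nat.even_add_one] at hn)]
      rw [cob, hd']
      exact fun v ⟨p, hp⟩ => eq_zero_of_repEven_eq_dOdd hp.symm
  · rw [hd]
    intro p hp
    cases n with
    | zero =>
      obtain ⟨v, a, hv⟩ := exists_repEven_add_d1 hp
      exact ⟨v, a, by rw [hv, add_sub_cancel_left]; rfl⟩
    | succ n =>
      have hd' : delta k (n + 1) = dOdd k := by
        rw [delta, if_neg (by rwa [Nat.even_add_one] at hn)]
      obtain ⟨v, a, hv⟩ := exists_repEven_add_dOdd hp
      exact ⟨v, a, by rw [hv, add_sub_cancel_left, hd']⟩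

theorem basisOdd [CharZero k] (h : QuasiIso (augmentation k)) (n : ℕ) (hn : Even n) :
    ClassesFormBasis k h (n + 2) (Sum.elim (v k) (w k)) := by
  have hd : delta k (n + 1) = dEven k := by rw [delta, if_pos hn]
  have hd' : delta k (n + 2) = dOdd k := by
    rw [delta, if_neg (by rwa [Nat.even_add_one, not_not])]
  refine classesFormBasis_of_linearMap h _ _ _ repOdd_basis
    (fun v => by rw [hd', dOdd_repOdd]) ?_ ?_
  · rw [cob, hd]
    exact fun v ⟨p, hp⟩ => eq_zero_of_repOdd_eq_dEven hp.symm
  · rw [hd', cob, hd]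
    intro p hp
    obtain ⟨v, a, hv⟩ := exists_repOdd_add_dEven hp
    exact ⟨v, a, by rw [hv, add_sub_cancel_left]⟩

/-- Bimodule endomorphisms of `A` are the multiplications by scalars. -/
noncomputable def scalarEnd : k →ₗ[k] (bimod k ⟶ bimod k) := LinearMap.toSpanSingleton k _ (𝟙 _)

theorem scalarEnd_hom_apply (r : k) (a : A k) : (scalarEnd r).hom a = r • a := by
  change ten (algebraMap k (A k) r) 1 • a = _
  rw [ten_smul, mul_one, Algebra.smul_def]

/-- A bimodule endomorphism is multiplication by its value at 1, which is central and hence a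
scalar. -/
theorem scalarEnd_bijective [CharZero k] : Function.Bijective (scalarEnd (k := k)) := by
  constructor
  · rw [injective_iff_map_eq_zero]
    intro r hr
    have h := scalarEnd_hom_apply r 1
    rw [hr] at h
    have h1 : (0 : A k) = r • 1 := h
    rw [← nf_one, ← map_smul, ← map_zero nf] at h1
    have h2 : ofCoord (r • (1 : R k), 0, 0, 0) = 0 := by
      simpa [ofCoord_mk] using h1.symm
    rw [ofCoord_eq_zero_iff] at h2
    simpa using h2.1
  · intro φ
    let f : A k →ₗ[Ae k] A k := φ.hom
    have hl (a : A k) : f a = a * f 1 := by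
      have := f.map_smul (ten a 1) 1
      simpa [ten_smul] using this
    have hr (a : A k) : f a = f 1 * a := by
      have := f.map_smul (ten 1 a) 1
      simpa [ten_smul] using this
    have hc : f 1 ∈ Subalgebra.center k (A k) :=
      Subalgebra.mem_center_iff.mpr fun b => by rw [← hl, hr]
    rw [center_eq_bot, Algebra.mem_bot] at hc
    obtain ⟨r, hr'⟩ := hc
    refine ⟨r, ModuleCat.hom_ext (LinearMap.ext fun a => ?_)⟩
    refine (scalarEnd_hom_apply r a).trans ?_
    change _ = f a
    rw [hr, ← hr', Algebra.smul_def]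

end Ext

end SuperJordanPlane

theorem mainTheorem6 (k : Type u) [Field k] [CharZero k] :
    Nonempty (SuperJordanPlane.HH k 0 ≃ₗ[k] k) ∧
    Subalgebra.center k (SuperJordanPlane.A k) = ⊥ ∧
    ∃ h : QuasiIso (SuperJordanPlane.augmentation k),
      SuperJordanPlane.ClassesFormBasis k h 0
        (Sum.elim (fun _ : Unit => SuperJordanPlane.c k) (SuperJordanPlane.s k)) ∧
      (∀ p : ℕ, 1 ≤ p → SuperJordanPlane.ClassesFormBasis k h (2 * p - 1)
        (Sum.elim (SuperJordanPlane.t k) (SuperJordanPlane.u k))) ∧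
      (∀ p : ℕ, 1 ≤ p → SuperJordanPlane.ClassesFormBasis k h (2 * p)
        (Sum.elim (SuperJordanPlane.v k) (SuperJordanPlane.w k))) := by
  refine ⟨⟨Ext.linearEquiv₀.trans
    (LinearEquiv.ofBijective _ SuperJordanPlane.scalarEnd_bijective).symm⟩,
    SuperJordanPlane.center_eq_bot, SuperJordanPlane.quasiIso_augmentation k,
    SuperJordanPlane.basisOne _, fun p hp => ?_, fun p hp => ?_⟩
  -- Index i of `ClassesFormBasis` means degree i + 1, so degree 2p has index 2p - 1, which is 2n +
  -- 1 for p = n + 1.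
  · obtain ⟨n, rfl⟩ : ∃ n, p = n + 1 := ⟨p - 1, by omega⟩
    exact SuperJordanPlane.basisEven _ (2 * n) (even_two_mul n)
  · obtain ⟨n, rfl⟩ : ∃ n, p = n + 1 := ⟨p - 1, by omega⟩
    exact SuperJordanPlane.basisOdd _ (2 * n) (even_two_mul n)
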